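/- Let $N\ge 0$ be an integer and let $k\ge 0$ be real. The group $S_N$ acts on polynomials in $\mathbb R[x_1,\dots,x_N]$ by $(wf)(x)=f(xw)$, $(xw)_i=x_{w(i)}$, and on compositions $\alpha\in\mathbb Z_{\ge 0}^N$ by $(w\alpha)_i=\alpha_{w^{-1}(i)}$. For $1\le i\le N$ let $$T_i=\frac{\partial}{\partial x_i}+k\sum_{j\ne i}\frac{1-(ij)}{x_i-x_j},\qquad U_i=T_ix_i+k-k\sum_{j<i}(ij),$$ where $T_ix_i$ is the operator $f\mapsto T_i(x_if)$, and for a composition $\alpha$ let $$\kappa_i(\alpha)=Nk-k\bigl(\#\{s:\alpha_s>\alpha_i\}+\#\{s<i:\alpha_s=\alpha_i\}\bigr)+\alpha_i+1 .$$ Write $|\alpha|=\sum_i\alpha_i$, and let $\alpha^+$ be the decreasing rearrangement of $\alpha$. Write $\alpha\succeq\beta$ if $\sum_{i\le j}\alpha_i\ge\sum_{i\le j}\beta_i$ for all $1\le j\le N$, and $\alpha\succ\beta$ if moreover $\alpha\neq\beta$. The polynomials $p_\alpha$ are defined by $$\sum_\alpha p_\alpha(x)y^\alpha=\prod_{i=1}^N\Bigl\{(1-x_iy_i)^{-1}\prod_{j=1}^N(1-x_iy_j)^{-k}\Bigr\}.$$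 For a partition $\lambda$ (a composition with $\lambda_1\ge\dots\ge\lambda_N$), let $E_\lambda$ be the polynomial with $U_iE_\lambda=\kappa_i(\lambda)E_\lambda$ for all $i$ that has the form $x^\lambda$ plus a linear combination of monomials $x^\beta$ with $|\beta|=|\lambda|$ and either $\beta^+\prec\lambda$, or $\beta^+=\lambda$ and $\beta\prec\lambda$. Let $\omega_\lambda$ be the scalar multiple of $E_\lambda$ that has the form $p_\lambda$ plus a linear combination of polynomials $p_\beta$ with $|\beta|=|\lambda|$ and $\beta^+\succ\lambda$. Put $\omega_{w\lambda}=w\,\omega_\lambda$ for $w\in S_N$ (this is well defined). For a composition $\alpha$, let $\zeta_\alpha$ be the polynomial with $U_i\zeta_\alpha=\kappa_i(\alpha)\zeta_\alpha$ for $1\le i\le N$ that has the form $\omega_\alpha$ plus a linear combination of polynomials $\omega_\beta$ with $\beta^+=\alpha^+$ and $\beta\succ\alpha$. Let $I=[\ell+1,\ell+m]\subseteq[1,N]$ be an interval of integers, let $S_I=\{w\in S_N: w(i)=i\text{ for all } i\notin I\}$, and for a composition $\beta$ and a sign $\epsilon=\pm$ let $$\mathcal E_\epsilon(\beta;I)=\prod\Bigl\{1+\frac{\epsilon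 k}{\kappa_j(\beta)-\kappa_i(\beta)}:\ i,j\in I,\ i<j,\ \beta_i<\beta_j\Bigr\}.$$ **Proposition 3.12.** Let $\alpha$ be a composition with $\alpha_i\ge\alpha_j$ whenever $i,j\in I$ and $i<j$, and let $\beta=w\alpha$ for some $w\in S_I$. Then $$\zeta_\beta(1^N)=\mathcal E_-(\beta;I)\,\zeta_\alpha(1^N),\qquad 1^N=(1,\dots,1).$$ Moreover, let $\langle\cdot,\cdot\rangle$ be any inner product (or, more generally, any symmetric bilinear form) on $\mathbb R[x_1,\dots,x_N]$ for which every operator $T_ix_i$ is self-adjoint and which is $S_N$-invariant, $\langle wf,g\rangle=\langle f,w^{-1}g\rangle$. With $\|f\|^2=\langle f,f\rangle$, $$\|\zeta_\beta\|^2=\mathcal E_+(\beta;I)\,\mathcal E_-(\beta;I)\,\|\zeta_\alpha\|^2 .$$ -/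

import Mathlib

noncomputable section

namespace NonsymJack

open MvPolynomial

variable {N : ℕ}

/-! Indices are `Fin N = {0, …, N-1}` in place of `{1, …, N}`. -/

/-- Real polynomials in `x_1, …, x_N`. -/
abbrev Poly (N : ℕ) : Type := MvPolynomial (Fin N) ℝ

/-- Compositions `α ∈ ℤ₊^N`. -/
abbrev Comp (N : ℕ) : Type := Fin N → ℕ

/-- The exponent vector of the monomial `x^α`. -/
def expo (α : Comp N) : Fin N →₀ ℕ := Finsupp.equivFunOnFinite.symm α

/-- The action of `w ∈ S_N` on polynomials, `(w f)(x) = f(xw)`, `(xw)_i = x_{w(i)}`. -/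
def act (w : Equiv.Perm (Fin N)) : Poly N →ₗ[ℝ] Poly N :=
  (rename w : Poly N →ₐ[ℝ] Poly N).toLinearMap

/-- The action on compositions, `(w α)_i = α_{w⁻¹(i)}`. -/
def compAct (w : Equiv.Perm (Fin N)) (α : Comp N) : Comp N := fun i => α (w⁻¹ i)

/-! ### Dunkl and Cherednik operators -/

theorem X_sub_X_dvd (i j : Fin N) (f : Poly N) :
    (X i - X j : Poly N) ∣ f - act (Equiv.swap i j) f := by
  rw [← Ideal.mem_span_singleton, ← Ideal.Quotient.eq]
  have key : (Ideal.Quotient.mkₐ ℝ (Ideal.span {(X i - X j : Poly N)})) =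
      (Ideal.Quotient.mkₐ ℝ (Ideal.span {(X i - X j : Poly N)})).comp
        (rename (Equiv.swap i j)) := by
    have hij : (Ideal.Quotient.mk (Ideal.span {(X i - X j : Poly N)})) (X i) =
        (Ideal.Quotient.mk (Ideal.span {(X i - X j : Poly N)})) (X j) := by
      rw [Ideal.Quotient.eq, Ideal.mem_span_singleton]
    refine MvPolynomial.algHom_ext fun l => ?_
    simp only [AlgHom.comp_apply, rename_X, Ideal.Quotient.mkₐ_eq_mk]
    by_cases h1 : l = i
    · subst h1; rw [Equiv.swap_apply_left]; exact hij
    · by_cases h2 : l = j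
      · subst h2; rw [Equiv.swap_apply_right]; exact hij.symm
      · rw [Equiv.swap_apply_of_ne_of_ne h1 h2]
  exact DFunLike.congr_fun key f

theorem X_sub_X_ne_zero {i j : Fin N} (h : i ≠ j) : (X i - X j : Poly N) ≠ 0 :=
  sub_ne_zero.mpr fun e => h (X_injective e)

/-- The quotient `(f - (ij) f) / (x_i - x_j)`, a polynomial (for `i ≠ j`). -/
def divDiff {i j : Fin N} (h : i ≠ j) : Poly N →ₗ[ℝ] Poly N where
  toFun f := (X_sub_X_dvd i j f).choose
  map_add' f g := by
    apply mul_left_cancel₀ (X_sub_X_ne_zero h)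
    rw [mul_add, ← (X_sub_X_dvd i j (f + g)).choose_spec, ← (X_sub_X_dvd i j f).choose_spec,
      ← (X_sub_X_dvd i j g).choose_spec, map_add]
    ring
  map_smul' c f := by
    apply mul_left_cancel₀ (X_sub_X_ne_zero h)
    rw [RingHom.id_apply, mul_smul_comm, ← (X_sub_X_dvd i j (c • f)).choose_spec,
      ← (X_sub_X_dvd i j f).choose_spec, map_smul, smul_sub]

theorem X_sub_X_mul_divDiff {i j : Fin N} (h : i ≠ j) (f : Poly N) :
    (X i - X j) * divDiff h f = f - act (Equiv.swap i j) f :=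
  (X_sub_X_dvd i j f).choose_spec.symm

/-- The type A Dunkl operator `T_i = ∂/∂x_i + k ∑_{j ≠ i} (1 - (ij)) / (x_i - x_j)`. -/
def dunkl (k : ℝ) (i : Fin N) : Poly N →ₗ[ℝ] Poly N :=
  (pderiv i).toLinearMap + k • ∑ j : Fin N, if h : i ≠ j then divDiff h else 0

/-- The operator `T_i x_i : f ↦ T_i (x_i f)`. -/
def dunklX (k : ℝ) (i : Fin N) : Poly N →ₗ[ℝ] Poly N :=
  dunkl k i ∘ₗ LinearMap.mulLeft ℝ (X i)

/-- The commuting operators `U_i = T_i ρ_i - k ∑_{j < i} (ij)`, where `T_i ρ_i = T_i x_i + k`. -/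
def cherednik (k : ℝ) (i : Fin N) : Poly N →ₗ[ℝ] Poly N :=
  dunklX k i + k • LinearMap.id - k • ∑ j ∈ Finset.univ.filter (· < i), act (Equiv.swap i j)

/-- `κ_i(α) = Nk - k (#{s : α_s > α_i} + #{s : s < i, α_s = α_i}) + α_i + 1`. -/
def kappa (k : ℝ) (α : Comp N) (i : Fin N) : ℝ :=
  (N : ℝ) * k
    - k * (((Finset.univ.filter fun s => α i < α s).card : ℝ)
      + ((Finset.univ.filter fun s => s < i ∧ α s = α i).card : ℝ))
    + (α i : ℝ) + 1

/-! ### The dual basis `p_α` -/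

/-- The power series `∑_n c_n x_i^n y_j^n` in the variables `y`, with coefficients polynomials
in the variables `x`. -/
def xySeries (c : ℕ → ℝ) (i j : Fin N) : MvPowerSeries (Fin N) (Poly N) :=
  fun d => if d = Finsupp.single j (d j) then c (d j) • X i ^ d j else 0

/-- The coefficients `(k)_n / n!` of `(1 - t)^{-k} = ∑_n (k)_n t^n / n!`. -/
def binomCoeff (k : ℝ) (n : ℕ) : ℝ := (ascPochhammer ℝ n).eval k / (n.factorial : ℝ)

/-- The generating function `F_k(x, y) = ∏_i (1 - x_i y_i)^{-1} ∏_{i,j} (1 - x_i y_j)^{-k}`. -/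
def genFun (k : ℝ) : MvPowerSeries (Fin N) (Poly N) :=
  ∏ i : Fin N, (xySeries (fun _ => 1) i i * ∏ j : Fin N, xySeries (binomCoeff k) i j)

/-- `p_α(x)`, the coefficient of `y^α` in `F_k(x, y)`. -/
def pPoly (k : ℝ) (α : Comp N) : Poly N := MvPowerSeries.coeff (expo α) (genFun k)

/-! ### Orders on compositions -/

/-- `Dominates α β` is `α ⪰ β`: every partial sum of `α` is at least that of `β`. -/
def Dominates (α β : Comp N) : Prop :=
  ∀ j : Fin N, ∑ i ∈ Finset.univ.filter (· ≤ j), β i ≤ ∑ i ∈ Finset.univ.filter (· ≤ j), α i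

/-- `α ≻ β`. -/
def StrictlyDominates (α β : Comp N) : Prop := Dominates α β ∧ α ≠ β

/-- `|α|`. -/
def size (α : Comp N) : ℕ := ∑ i, α i

/-- A permutation that sorts `α` into decreasing order. -/
def sortPerm (α : Comp N) : Equiv.Perm (Fin N) := Fin.revPerm.trans (Tuple.sort α)

/-- The partition `α⁺`, the decreasing rearrangement of `α`. -/
def plus (α : Comp N) : Comp N := α ∘ sortPerm α

theorem plus_antitone (α : Comp N) : Antitone (plus α) := fun _ _ h =>
  Tuple.monotone_sort α (Fin.rev_le_rev.mpr h)

theorem compAct_sortPerm_plus (α : Comp N) : compAct (sortPerm α) (plus α) = α := by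
  funext i
  simp [compAct, plus]

/-! ### The polynomials `ω_α` and `ζ_α` -/

/-- `f` is the nonsymmetric Jack polynomial `E_α(x; 1/k)`: the simultaneous eigenfunction of the
`U_i` of the form `x^α + ∑ A'(β, α) x^β`, the sum over `|β| = |α|` with `β⁺ ≺ α⁺`, or `β⁺ = α⁺`
and `β ≺ α`. -/
def IsMonicJack (k : ℝ) (α : Comp N) (f : Poly N) : Prop :=
  (∀ i, cherednik k i f = kappa k α i • f) ∧
  f.coeff (expo α) = 1 ∧
  ∀ β : Comp N, β ≠ α → f.coeff (expo β) ≠ 0 →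
    size β = size α ∧
      (StrictlyDominates (plus α) (plus β) ∨ (plus β = plus α ∧ StrictlyDominates α β))

/-- For a partition `lam`: `f = ω_lam` is the scalar multiple of `E_lam(x; 1/k)` of the form
`p_lam + ∑ B(β, lam) p_β`, the sum over `|β| = |lam|` with `β⁺ ≻ lam`. -/
def IsOmega (k : ℝ) (lam : Comp N) (f : Poly N) : Prop :=
  (∃ (c : ℝ) (g : Poly N), IsMonicJack k lam g ∧ f = c • g) ∧
  f - pPoly k lam ∈ Submodule.span ℝ
    (pPoly k '' {β : Comp N | size β = size lam ∧ StrictlyDominates (plus β) lam})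

open Classical in
/-- `ω_lam` for a partition `lam`. -/
def omegaPart (k : ℝ) (lam : Comp N) : Poly N :=
  if h : ∃ f, IsOmega k lam f then h.choose else 0

/-- `ω_α = w ω_{α⁺}`, where `α = w α⁺` (any such `w` gives the same polynomial). -/
def omega (k : ℝ) (α : Comp N) : Poly N := act (sortPerm α) (omegaPart k (plus α))

/-- The characterization of `ζ_α`: a simultaneous eigenfunction `U_i ζ_α = κ_i(α) ζ_α` of the
form `ω_α + ∑ B(β, α) ω_β`, the sum over `β⁺ = α⁺` with `β ≻ α`. -/
def IsZeta (k : ℝ) (α : Comp N) (f : Poly N) : Prop :=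
  (∀ i, cherednik k i f = kappa k α i • f) ∧
  f - omega k α ∈ Submodule.span ℝ
    (omega k '' {β : Comp N | plus β = plus α ∧ StrictlyDominates β α})

open Classical in
/-- The nonsymmetric Jack polynomial `ζ_α`. -/
def zeta (k : ℝ) (α : Comp N) : Poly N :=
  if h : ∃ f, IsZeta k α f then h.choose else 0

/-- Evaluation at `1^N = (1, …, 1)`. -/
def evalOne (f : Poly N) : ℝ := MvPolynomial.eval (fun _ => (1 : ℝ)) f

/-! ### Permissible inner products -/

/-- A symmetric bilinear form on polynomials for which each `T_i x_i` is self-adjoint and which is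
`S_N`-invariant. The permissible inner products are the positive definite ones among these;
positivity is not needed for what follows and is not asked for. -/
structure IsPermissible (k : ℝ) (B : LinearMap.BilinForm ℝ (Poly N)) : Prop where
  symm : ∀ f g, B f g = B g f
  selfAdjoint : ∀ i f g, B (dunklX k i f) g = B f (dunklX k i g)
  invariant : ∀ (w : Equiv.Perm (Fin N)) (f g), B (act w f) g = B f (act w⁻¹ g)

/-! ### Intervals -/

/-- The interval `I = [ℓ+1, ℓ+m]`; with indices starting at `0` it is `{ℓ, …, ℓ+m-1}`. -/
def interval (N l m : ℕ) : Finset (Fin N) :=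
  Finset.univ.filter fun i => l ≤ (i : ℕ) ∧ (i : ℕ) < l + m

/-- `S_I = {w ∈ S_N : w(i) = i for all i ∉ I}`. -/
def permsOf (I : Finset (Fin N)) : Set (Equiv.Perm (Fin N)) := {w | ∀ i, i ∉ I → w i = i}

/-- `α` satisfies `(≥, I)`. -/
def SatGE (α : Comp N) (I : Finset (Fin N)) : Prop :=
  ∀ i ∈ I, ∀ j ∈ I, i < j → α j ≤ α i

/-- `ℰ_ε(β; I) = ∏ {1 + ε k / (κ_j(β) - κ_i(β)) : i, j ∈ I, i < j, β_i < β_j}`,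
with `ε = 1` or `ε = -1`. -/
def calE (k ε : ℝ) (β : Comp N) (I : Finset (Fin N)) : ℝ :=
  ∏ q ∈ (I ×ˢ I).filter (fun q => q.1 < q.2 ∧ β q.1 < β q.2),
    (1 + ε * k / (kappa k β q.2 - kappa k β q.1))

end NonsymJack

end

noncomputable section

namespace NonsymJack

open MvPolynomial

variable {N : ℕ}

/-! ### The symmetric group action and the Hecke relation -/

/-! Everything reduces to one adjacent transposition `s = (i, i+1)` inside the interval. Let `α i >
α (i+1)` and `c = k / (κ_i(α) - κ_{i+1}(α))`. The core identity is `ζ_{sα} = s ζ_α - c ζ_α`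
(`zeta_swap`). Evaluation at `1^N` is `S_N`-invariant, so it picks up the factor `1 - c`. For a
permissible form, `ζ_{sα}` and `ζ_α` are orthogonal, which forces `⟨s ζ_α, ζ_α⟩ = c ‖ζ_α‖²` and
hence the norm factor `1 - c²`. Passing from `α` to `sα` multiplies `ℰ_ε` by exactly `1 + ε c`
(`calE_swap`), and every rearrangement inside the interval is reached by such swaps
(`rearrangement_induction`).

The core identity has two ingredients. By the degenerate affine Hecke relations, `s - c` carries
joint eigenfunctions of the `U_i` to joint eigenfunctions with the swapped spectral vector. Joint
eigenspaces are at most one-dimensional (`IsEigen.eq_smul`): the `U_i` are triangular on monomials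
with diagonal entries `κ_i`, and `κ(α)` determines `α`. Thus `s ζ_α - c ζ_α` is a multiple of
`ζ_{sα}`, and the coefficient of `ω_{sα}` fixes the multiple as `1`.

That coefficient makes sense because the `ω_β` with `β⁺ = λ` are linearly independent when `ω_λ ≠
0`, and `ζ_α` exists in that case because the `U_i` are also triangular on the `ω_β`, by dominance.
The existence of `E_λ` and `ω_λ` is never needed: if `omegaPart` vanishes, so do all the `ζ`
concerned, and the formulas hold trivially. -/

theorem act_act (w v : Equiv.Perm (Fin N)) (f : Poly N) : act w (act v f) = act (w * v) f := by
  simp [act, rename_rename]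

theorem act_one (f : Poly N) : act 1 f = f := by
  simp [act]

theorem act_mul (w : Equiv.Perm (Fin N)) (f g : Poly N) : act w (f * g) = act w f * act w g := by
  simp [act]

theorem act_X (w : Equiv.Perm (Fin N)) (i : Fin N) : act w (X i) = X (w i) := by
  simp [act]

theorem act_swap_swap (i j : Fin N) (f : Poly N) :
    act (Equiv.swap i j) (act (Equiv.swap i j) f) = f := by
  rw [act_act, Equiv.swap_mul_self, act_one]

theorem evalOne_act (w : Equiv.Perm (Fin N)) (f : Poly N) : evalOne (act w f) = evalOne f := by
  simp [evalOne, act, eval_rename, Function.comp_def]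

theorem divDiff_eq_of_mul_eq {i j : Fin N} (h : i ≠ j) {f g : Poly N}
    (hg : (X i - X j) * g = f - act (Equiv.swap i j) f) : divDiff h f = g :=
  mul_left_cancel₀ (X_sub_X_ne_zero h) ((X_sub_X_mul_divDiff h f).trans hg.symm)

theorem act_divDiff (w : Equiv.Perm (Fin N)) {i j : Fin N} (h : i ≠ j) (f : Poly N) :
    act w (divDiff h f) = divDiff (w.injective.ne h) (act w f) := by
  symm
  apply divDiff_eq_of_mul_eq
  rw [← act_X, ← act_X, ← map_sub, ← act_mul, X_sub_X_mul_divDiff, map_sub, act_act, act_act,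
    Equiv.swap_apply_apply]
  simp

theorem act_dunkl (k : ℝ) (w : Equiv.Perm (Fin N)) (i : Fin N) (f : Poly N) :
    act w (dunkl k i f) = dunkl k (w i) (act w f) := by
  have h1 : act w (pderiv i f) = pderiv (w i) (act w f) := (pderiv_rename w.injective i f).symm
  simp only [dunkl, LinearMap.add_apply, LinearMap.smul_apply, map_add, map_smul,
    LinearMap.sum_apply, map_sum]
  congr 1
  congr 1
  conv_rhs => rw [← Equiv.sum_comp w]
  refine Finset.sum_congr rfl fun j _ => ?_
  by_cases h : i = j
  · simp [h]
  · rw [dif_pos h, dif_pos (w.injective.ne h), act_divDiff]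

theorem act_dunklX (k : ℝ) (w : Equiv.Perm (Fin N)) (i : Fin N) (f : Poly N) :
    act w (dunklX k i f) = dunklX k (w i) (act w f) := by
  simp [dunklX, act_dunkl, act_mul, act_X]

theorem cherednik_apply (k : ℝ) (i : Fin N) (f : Poly N) :
    cherednik k i f = dunklX k i f + k • f
      - k • ∑ j ∈ Finset.univ.filter (· < i), act (Equiv.swap i j) f := by
  simp [cherednik]

/-- The part `T_i x_i + k` is equivariant; only the sum of transpositions depends on the ordering of
the indices, and it is conjugated term by term. -/
theorem act_cherednik (k : ℝ) (w : Equiv.Perm (Fin N)) (i : Fin N) (f : Poly N) :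
    act w (cherednik k i f) = dunklX k (w i) (act w f) + k • act w f
      - k • ∑ j ∈ Finset.univ.filter (· < i), act (Equiv.swap (w i) (w j)) (act w f) := by
  simp only [cherednik_apply, map_sub, map_add, map_smul, map_sum, act_dunklX, act_act]
  congr 2
  refine Finset.sum_congr rfl fun j _ => ?_
  rw [Equiv.swap_apply_apply]
  simp

/-- The degenerate affine Hecke relation for the simple transposition `(i, i+1)`. -/
theorem act_swap_cherednik (k : ℝ) {i j : Fin N} (hij : (j : ℕ) = i + 1) (f : Poly N) :
    act (Equiv.swap i j) (cherednik k i f)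
      = cherednik k j (act (Equiv.swap i j) f) + k • f := by
  have hlt : i < j := by rw [Fin.lt_def]; omega
  rw [act_cherednik, cherednik_apply, Equiv.swap_apply_left]
  have hf : Finset.univ.filter (· < j) = insert i (Finset.univ.filter (· < i)) := by
    ext l
    simp only [Finset.mem_filter, Finset.mem_univ, true_and, Finset.mem_insert, Fin.lt_def,
      Fin.ext_iff]
    omega
  rw [hf, Finset.sum_insert (by simp), Equiv.swap_comm j i, act_swap_swap]
  have hs : ∀ l ∈ Finset.univ.filter (· < i),
      act (Equiv.swap j (Equiv.swap i j l)) (act (Equiv.swap i j) f)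
        = act (Equiv.swap j l) (act (Equiv.swap i j) f) := by
    intro l hl
    have hl' : l < i := by simpa using hl
    rw [Equiv.swap_apply_of_ne_of_ne hl'.ne (hl'.trans hlt).ne]
  rw [Finset.sum_congr rfl hs, smul_add]
  abel

theorem act_swap_cherednik_right (k : ℝ) {i j : Fin N} (hij : (j : ℕ) = i + 1) (f : Poly N) :
    act (Equiv.swap i j) (cherednik k j f)
      = cherednik k i (act (Equiv.swap i j) f) - k • f := by
  have h := act_swap_cherednik k hij (act (Equiv.swap i j) f)
  rw [act_swap_swap] at h
  have h2 := congrArg (act (Equiv.swap i j)) h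
  rw [act_swap_swap, map_add, map_smul, act_swap_swap] at h2
  rw [h2, add_sub_cancel_right]

theorem act_swap_cherednik_of_ne (k : ℝ) {i j l : Fin N} (hij : (j : ℕ) = i + 1) (hi : l ≠ i)
    (hj : l ≠ j) (f : Poly N) :
    act (Equiv.swap i j) (cherednik k l f) = cherednik k l (act (Equiv.swap i j) f) := by
  rw [act_cherednik, cherednik_apply, Equiv.swap_apply_of_ne_of_ne hi hj]
  congr 2
  -- Since `l` is neither `i` nor `i + 1`, the swap permutes the indices below `l` among themselves.
  refine Finset.sum_bij' (fun a _ => Equiv.swap i j a) (fun a _ => Equiv.swap i j a) ?_ ?_ ?_ ?_ ?_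
  all_goals try simp
  all_goals
    intro a ha
    rw [Fin.lt_def] at *
    rw [Ne, Fin.ext_iff] at hi hj
    rw [Equiv.swap_apply_def]
    split_ifs with h1 h2
    · subst h1; omega
    · subst h2; omega
    · exact ha

/-- The intertwiner of `U_i` and `U_{i+1}`: it maps joint eigenfunctions to joint
eigenfunctions. -/
theorem cherednik_intertwiner (k : ℝ) {i j : Fin N} (hij : (j : ℕ) = i + 1) {f : Poly N}
    {v : Fin N → ℝ} (hf : ∀ l, cherednik k l f = v l • f) {c : ℝ} (hc : c * (v i - v j) = -k)
    (l : Fin N) :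
    cherednik k l (act (Equiv.swap i j) f + c • f)
      = v (Equiv.swap i j l) • (act (Equiv.swap i j) f + c • f) := by
  rw [map_add, map_smul, hf]
  by_cases hi : l = i
  · subst hi
    have h := act_swap_cherednik_right k hij f
    rw [hf, map_smul, eq_sub_iff_add_eq] at h
    rw [← h, Equiv.swap_apply_left]
    have hk : k = -(c * (v l - v j)) := by linarith
    rw [hk]
    module
  · by_cases hj : l = j
    · subst hj
      have h := act_swap_cherednik k hij f
      rw [hf, map_smul, ← sub_eq_iff_eq_add] at h
      rw [← h, Equiv.swap_apply_right]
      have hk : k = -(c * (v i - v l)) := by linarith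
      rw [hk]
      module
    · rw [← act_swap_cherednik_of_ne k hij hi hj, hf, map_smul,
        Equiv.swap_apply_of_ne_of_ne hi hj]
      module

/-! ### Triangularity of the Cherednik operators on monomials -/

/-- The monomial `x^α`. -/
def mono (α : Comp N) : Poly N := monomial (expo α) 1

theorem expo_injective : Function.Injective (expo : Comp N → _) :=
  Finsupp.equivFunOnFinite.symm.injective

theorem expo_apply (α : Comp N) (i : Fin N) : expo α i = α i := rfl

theorem mono_eq_prod (α : Comp N) : mono α = ∏ i, (X i : Poly N) ^ α i := by
  rw [mono, monomial_eq, Finsupp.prod_fintype]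
  · simp [expo_apply]
  · simp

theorem act_mono (w : Equiv.Perm (Fin N)) (α : Comp N) : act w (mono α) = mono (compAct w α) := by
  rw [mono_eq_prod, mono_eq_prod, ← Equiv.prod_comp w (fun i => X i ^ compAct w α i)]
  simp [act, compAct]

theorem coeff_mono (α β : Comp N) : (mono α).coeff (expo β) = if β = α then 1 else 0 := by
  rw [mono, coeff_monomial]
  simp only [expo_injective.eq_iff, eq_comm]

theorem coeff_act (w : Equiv.Perm (Fin N)) (α : Comp N) (f : Poly N) :
    (act w f).coeff (expo (compAct w α)) = f.coeff (expo α) := by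
  have h : expo (compAct w α) = (expo α).mapDomain w := by
    ext i
    rw [Finsupp.mapDomain_equiv_apply]
    rfl
  rw [h]
  exact coeff_rename_mapDomain w w.injective f _

theorem sum_coeff_smul_mono (f : Poly N) :
    f = ∑ d ∈ f.support, f.coeff d • mono (Finsupp.equivFunOnFinite d) := by
  conv_lhs => rw [f.as_sum]
  refine Finset.sum_congr rfl fun d _ => ?_
  rw [mono, expo, Equiv.symm_apply_apply, smul_monomial, smul_eq_mul, mul_one]

/-- The factor of `x^α` that does not involve `x_i` and `x_j`. -/
def monoRest (i j : Fin N) (α : Comp N) : Poly N :=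
  ∏ l ∈ Finset.univ.filter (fun l => l ≠ i ∧ l ≠ j), X l ^ α l

/-- `α` with the entries at `i` and `j` replaced by `a` and `b`. -/
def replaceTwo (α : Comp N) (i j : Fin N) (a b : ℕ) : Comp N :=
  Function.update (Function.update α i a) j b

theorem sum_univ_split {M : Type*} [AddCommMonoid M] {i j : Fin N} (h : i ≠ j) (g : Fin N → M) :
    ∑ l, g l = g i + g j + ∑ l ∈ Finset.univ.filter (fun l => l ≠ i ∧ l ≠ j), g l := by
  have h2 : (Finset.univ : Finset (Fin N))
      = insert i (insert j (Finset.univ.filter (fun l => l ≠ i ∧ l ≠ j))) := by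
    ext l
    simp only [Finset.mem_univ, Finset.mem_insert, Finset.mem_filter, true_and, true_iff]
    tauto
  conv_lhs => rw [h2]
  rw [Finset.sum_insert (by simp [h]), Finset.sum_insert (by simp), add_assoc]

theorem mono_replaceTwo {i j : Fin N} (h : i ≠ j) (α : Comp N) (a b : ℕ) :
    mono (replaceTwo α i j a b) = monoRest i j α * (X i ^ a * X j ^ b) := by
  have h2 : (Finset.univ : Finset (Fin N))
      = insert i (insert j (Finset.univ.filter (fun l => l ≠ i ∧ l ≠ j))) := by
    ext l
    simp only [Finset.mem_univ, Finset.mem_insert, Finset.mem_filter, true_and, true_iff]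
    tauto
  rw [mono_eq_prod, h2, Finset.prod_insert (by simp [h]), Finset.prod_insert (by simp),
    ← mul_assoc, mul_comm, monoRest]
  congr 1
  · refine Finset.prod_congr rfl fun l hl => ?_
    simp only [Finset.mem_filter, Finset.mem_univ, true_and] at hl
    simp [replaceTwo, hl.1, hl.2]
  · simp [replaceTwo, h]

theorem replaceTwo_self (α : Comp N) (i j : Fin N) : replaceTwo α i j (α i) (α j) = α := by
  simp [replaceTwo]

theorem replaceTwo_swap (α : Comp N) (i j : Fin N) :
    replaceTwo α i j (α j) (α i) = compAct (Equiv.swap i j) α := by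
  funext l
  simp only [replaceTwo, compAct, Equiv.swap_inv, Equiv.swap_apply_def, Function.update_apply]
  split_ifs <;> simp_all

theorem sum_replaceTwo {i j : Fin N} (h : i ≠ j) (α : Comp N) (a b : ℕ) (g : Fin N → ℕ → ℕ) :
    ∑ l, g l (replaceTwo α i j a b l)
      = g i a + g j b + ∑ l ∈ Finset.univ.filter (fun l => l ≠ i ∧ l ≠ j), g l (α l) := by
  rw [sum_univ_split h]
  congr 1
  · simp [replaceTwo, h]
  · refine Finset.sum_congr rfl fun l hl => ?_
    simp only [Finset.mem_filter, Finset.mem_univ, true_and] at hl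
    simp [replaceTwo, hl.1, hl.2]

/-- `∑ α_i²`. -/
def sumSq (α : Comp N) : ℕ := ∑ i, α i ^ 2

/-- The sum of all entries, weighted by the distances of their positions from the right end. -/
def weight (α : Comp N) : ℕ := ∑ i, (i.rev : ℕ) * α i

theorem sumSq_replaceTwo_lt {i j : Fin N} (h : i ≠ j) (α : Comp N) {a b : ℕ}
    (hab : a ^ 2 + b ^ 2 < α i ^ 2 + α j ^ 2) : sumSq (replaceTwo α i j a b) < sumSq α := by
  rw [sumSq, sum_replaceTwo h α a b (fun _ x => x ^ 2), sumSq, sum_univ_split h]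
  omega

theorem sumSq_compAct (w : Equiv.Perm (Fin N)) (α : Comp N) : sumSq (compAct w α) = sumSq α :=
  Equiv.sum_comp w⁻¹ (fun i => α i ^ 2)

theorem weight_swap_lt {i j : Fin N} (h : i < j) {α : Comp N} (hα : α j < α i) :
    weight (compAct (Equiv.swap i j) α) < weight α := by
  rw [← replaceTwo_swap, weight, sum_replaceTwo h.ne α _ _ (fun l x => (l.rev : ℕ) * x), weight,
    sum_univ_split h.ne]
  have h1 : (j.rev : ℕ) < i.rev := by
    have := Fin.rev_lt_rev.mpr h
    exact this
  nlinarith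

/-- The level of a composition; the operators `U_i` are triangular on monomials with respect to
it. -/
def level (α : Comp N) : ℕ ×ₗ ℕ := toLex (sumSq α, weight α)

theorem level_lt_of_sumSq {α β : Comp N} (h : sumSq α < sumSq β) : level α < level β :=
  Prod.Lex.toLex_lt_toLex.mpr (Or.inl h)

theorem level_swap_lt {i j : Fin N} (h : i < j) {α : Comp N} (hα : α j < α i) :
    level (compAct (Equiv.swap i j) α) < level α :=
  Prod.Lex.toLex_lt_toLex.mpr (Or.inr ⟨sumSq_compAct _ _, weight_swap_lt h hα⟩)

/-- The span of the monomials of lower level. -/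
def lowerSpan (α : Comp N) : Submodule ℝ (Poly N) :=
  Submodule.span ℝ (mono '' {β | level β < level α})

theorem mono_mem_lowerSpan {α β : Comp N} (h : level β < level α) : mono β ∈ lowerSpan α :=
  Submodule.subset_span ⟨β, h, rfl⟩

theorem act_swap_monoRest (i j : Fin N) (α : Comp N) :
    act (Equiv.swap i j) (monoRest i j α) = monoRest i j α := by
  simp only [act, monoRest, AlgHom.toLinearMap_apply, map_prod, map_pow, rename_X]
  refine Finset.prod_congr rfl fun l hl => ?_
  simp only [Finset.mem_filter, Finset.mem_univ, true_and] at hl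
  rw [Equiv.swap_apply_of_ne_of_ne hl.1 hl.2]

theorem act_swap_monoRest_mul (i j : Fin N) (α : Comp N) (a b : ℕ) :
    act (Equiv.swap i j) (monoRest i j α * (X i ^ a * X j ^ b))
      = monoRest i j α * (X j ^ a * X i ^ b) := by
  rw [act_mul, act_swap_monoRest]
  simp [act]

theorem X_mul_mono {i j : Fin N} (h : i ≠ j) (α : Comp N) :
    X i * mono α = monoRest i j α * (X i ^ (α i + 1) * X j ^ α j) := by
  conv_lhs => rw [← replaceTwo_self α i j, mono_replaceTwo h]
  ring

/-- After removal of the common factors this is the geometric sum for `(x_i^{n+1} - x_j^{n+1}) /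
(x_i - x_j)`, where `n = α i - α j`. -/
theorem divDiff_X_mul_mono_of_le {i j : Fin N} (h : i ≠ j) {α : Comp N} (hα : α j ≤ α i) :
    divDiff h (X i * mono α)
      = ∑ t ∈ Finset.range (α i - α j + 1), mono (replaceTwo α i j (α j + t) (α i - t)) := by
  apply divDiff_eq_of_mul_eq
  rw [X_mul_mono h, act_swap_monoRest_mul]
  obtain ⟨n, hn⟩ := Nat.exists_eq_add_of_le hα
  simp only [mono_replaceTwo h, ← Finset.mul_sum]
  have hs : ∑ t ∈ Finset.range (α i - α j + 1), (X i ^ (α j + t) * X j ^ (α i - t) : Poly N)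
      = (X i * X j) ^ α j * ∑ t ∈ Finset.range (n + 1), X i ^ t * X j ^ (n + 1 - 1 - t) := by
    rw [Finset.mul_sum, hn, Nat.add_sub_cancel_left]
    refine Finset.sum_congr rfl fun t ht => ?_
    have : α j + n - t = α j + (n + 1 - 1 - t) := by
      have := Finset.mem_range.mp ht
      omega
    rw [this]
    ring
  have hg := (Commute.all (X i : Poly N) (X j)).mul_geom_sum₂ (n + 1)
  rw [hs, hn]
  linear_combination monoRest i j α * (X i * X j) ^ α j * hg

theorem divDiff_X_mul_mono_of_lt {i j : Fin N} (h : i ≠ j) {α : Comp N} (hα : α i < α j) :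
    divDiff h (X i * mono α)
      = -∑ t ∈ Finset.range (α j - α i - 1),
          mono (replaceTwo α i j (α i + 1 + t) (α j - 1 - t)) := by
  apply divDiff_eq_of_mul_eq
  rw [X_mul_mono h, act_swap_monoRest_mul]
  obtain ⟨n, hn⟩ := Nat.exists_eq_add_of_lt hα
  simp only [mono_replaceTwo h, ← Finset.mul_sum]
  have hs : ∑ t ∈ Finset.range (α j - α i - 1), (X i ^ (α i + 1 + t) * X j ^ (α j - 1 - t) : Poly N)
      = (X i * X j) ^ (α i + 1) * ∑ t ∈ Finset.range n, X i ^ t * X j ^ (n - 1 - t) := by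
    have : α j - α i - 1 = n := by omega
    rw [Finset.mul_sum, this]
    refine Finset.sum_congr rfl fun t ht => ?_
    have : α j - 1 - t = α i + 1 + (n - 1 - t) := by
      have := Finset.mem_range.mp ht
      omega
    rw [this]
    ring
  have hg := (Commute.all (X i : Poly N) (X j)).mul_geom_sum₂ n
  rw [hs, hn]
  linear_combination -(monoRest i j α * (X i * X j) ^ (α i + 1) * hg)

theorem sum_range_interior_mem {i j : Fin N} (h : i ≠ j) {α : Comp N} (s : Finset ℕ) (p q : ℕ → ℕ)
    (hs : ∀ t ∈ s, p t ^ 2 + q t ^ 2 < α i ^ 2 + α j ^ 2) :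
    ∑ t ∈ s, mono (replaceTwo α i j (p t) (q t)) ∈ lowerSpan α :=
  Submodule.sum_mem _ fun t ht =>
    mono_mem_lowerSpan (level_lt_of_sumSq (sumSq_replaceTwo_lt h α (hs t ht)))

/-- All exponent pairs in the sum have the same total as `(α i, α j)` and lie strictly between its
ends, so `∑ α_l²` drops by convexity. -/
theorem divDiff_mono_mem_of_lt {i j : Fin N} (h : i ≠ j) {α : Comp N} (hα : α i < α j) :
    divDiff h (X i * mono α) ∈ lowerSpan α := by
  rw [divDiff_X_mul_mono_of_lt h hα]
  refine Submodule.neg_mem _ (sum_range_interior_mem h _ _ _ fun t ht => ?_)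
  have ht' := Finset.mem_range.mp ht
  obtain ⟨m, hm⟩ := Nat.exists_eq_add_of_lt (show t < α j - α i - 1 from ht')
  have h1 : α j = α i + t + m + 2 := by omega
  have h2 : α j - 1 - t = α i + m + 1 := by omega
  rw [h2, h1]
  nlinarith [Nat.zero_le (t * m)]

theorem divDiff_mono_of_eq {i j : Fin N} (h : i ≠ j) {α : Comp N} (hα : α i = α j) :
    divDiff h (X i * mono α) = mono α := by
  rw [divDiff_X_mul_mono_of_le h hα.ge]
  have h1 : α i - α j + 1 = 1 := by omega
  rw [h1, Finset.sum_range_one, add_zero, Nat.sub_zero, replaceTwo_swap]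
  congr 1
  funext l
  simp only [compAct, Equiv.swap_inv, Equiv.swap_apply_def]
  split_ifs <;> simp_all

/-- Here the geometric sum reaches both ends: its last term is `x^α`, its first the swapped
monomial. The interior terms have smaller `∑ α_l²`. -/
theorem divDiff_mono_mem_of_gt {i j : Fin N} (h : i ≠ j) {α : Comp N} (hα : α j < α i) :
    divDiff h (X i * mono α) - mono α - mono (compAct (Equiv.swap i j) α) ∈ lowerSpan α := by
  rw [divDiff_X_mul_mono_of_le h hα.le]
  obtain ⟨n, hn⟩ := Nat.exists_eq_add_of_lt hα
  have h1 : α i - α j + 1 = n + 1 + 1 := by omega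
  rw [h1, Finset.sum_range_succ, Finset.sum_range_succ']
  have h2 : α i - (n + 1) = α j := by omega
  have h3 : α j + (n + 1) = α i := by omega
  rw [h2, h3, replaceTwo_self, add_zero, Nat.sub_zero, replaceTwo_swap, add_sub_cancel_right,
    add_sub_cancel_right]
  refine sum_range_interior_mem h _ _ _ fun t ht => ?_
  have ht' := Finset.mem_range.mp ht
  obtain ⟨m, hm⟩ := Nat.exists_eq_add_of_lt ht'
  have h4 : α i - (t + 1) = α j + m + 1 := by omega
  have h5 : α i = α j + t + m + 2 := by omega
  rw [h4, h5]
  nlinarith [Nat.zero_le (t * m)]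

theorem compAct_swap_eq_self {i j : Fin N} {α : Comp N} (hα : α i = α j) :
    compAct (Equiv.swap i j) α = α := by
  funext l
  simp only [compAct, Equiv.swap_inv, Equiv.swap_apply_def]
  split_ifs <;> simp_all

/-- The contribution of the index `j` to the triangularity of `U_i`. -/
theorem divDiff_sub_swap_mem {i j : Fin N} (h : i ≠ j) (α : Comp N) :
    divDiff h (X i * mono α) - (if j < i then mono (compAct (Equiv.swap i j) α) else 0)
      - ((if α j ≤ α i then 1 else 0) - (if j < i ∧ α j = α i then 1 else 0) : ℝ) • mono α
      ∈ lowerSpan α := by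
  rcases lt_trichotomy (α i) (α j) with hα | hα | hα
  · have h1 := divDiff_mono_mem_of_lt h hα
    rw [if_neg (not_le.mpr hα), if_neg (show ¬(j < i ∧ α j = α i) from fun h' => hα.ne' h'.2),
      sub_zero, zero_smul, sub_zero]
    split_ifs with hji
    · refine Submodule.sub_mem _ h1 (mono_mem_lowerSpan ?_)
      rw [Equiv.swap_comm]
      exact level_swap_lt hji hα
    · simpa using h1
  · rw [divDiff_mono_of_eq h hα, compAct_swap_eq_self hα, if_pos hα.ge]
    by_cases hji : j < i
    · rw [if_pos hji, if_pos ⟨hji, hα.symm⟩]; simp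
    · rw [if_neg hji, if_neg (fun h' => hji h'.1)]; simp
  · have h1 := divDiff_mono_mem_of_gt h hα
    rw [if_pos hα.le, if_neg (show ¬(j < i ∧ α j = α i) from fun h' => hα.ne h'.2), sub_zero,
      one_smul]
    by_cases hji : j < i
    · rw [if_pos hji]
      convert h1 using 1
      abel
    · rw [if_neg hji]
      have h2 := Submodule.add_mem _ h1
        (mono_mem_lowerSpan (level_swap_lt (lt_of_le_of_ne (not_lt.mp hji) h) hα))
      convert h2 using 1
      abel

theorem pderiv_X_mul_mono (i : Fin N) (α : Comp N) :
    pderiv i (X i * mono α) = ((α i : ℝ) + 1) • mono α := by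
  have h : X i * mono α = monomial (Finsupp.single i 1 + expo α) (1 : ℝ) := by
    rw [mono, X, monomial_mul, one_mul]
  rw [h, pderiv_monomial, mono, smul_monomial, add_tsub_cancel_left]
  simp [expo_apply, add_comm]

/-- Distributes `κ_i` over the indices `j ≠ i`, matching the diagonal contribution of each `j` to
`U_i x^α`. The separate `k` is the term `j = i` of `k #{j : α_j ≤ α_i}`. -/
theorem kappa_eq (k : ℝ) (α : Comp N) (i : Fin N) :
    kappa k α i = (α i : ℝ) + 1 + k + k * ∑ j ∈ Finset.univ.erase i,
      ((if α j ≤ α i then 1 else 0) - (if j < i ∧ α j = α i then 1 else 0) : ℝ) := by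
  have h1 : (N : ℝ) = ∑ j : Fin N, ((if α j ≤ α i then 1 else 0) + (if α i < α j then 1 else 0)) := by
    have : ∀ j, ((if α j ≤ α i then 1 else 0) + (if α i < α j then 1 else 0) : ℝ) = 1 := by
      intro j
      by_cases h : α j ≤ α i
      · simp [h, not_lt.mpr h]
      · simp [h, not_le.mp h]
    simp [this]
  have h2 : ∑ j : Fin N, ((if α j ≤ α i then 1 else 0)
      - (if j < i ∧ α j = α i then 1 else 0) : ℝ) = 1 + ∑ j ∈ Finset.univ.erase i,
      ((if α j ≤ α i then 1 else 0) - (if j < i ∧ α j = α i then 1 else 0) : ℝ) := by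
    rw [← Finset.add_sum_erase _ _ (Finset.mem_univ i)]
    simp
  rw [Finset.sum_sub_distrib] at h2
  rw [Finset.sum_add_distrib] at h1
  rw [kappa, Finset.card_filter, Finset.card_filter]
  push_cast
  linear_combination k * h1 + k * h2

theorem cherednik_mono_sub_mem (k : ℝ) (i : Fin N) (α : Comp N) :
    cherednik k i (mono α) - kappa k α i • mono α ∈ lowerSpan α := by
  have h1 : dunklX k i (mono α) = ((α i : ℝ) + 1) • mono α
      + k • ∑ j ∈ Finset.univ.erase i, (if h : i ≠ j then divDiff h else 0) (X i * mono α) := by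
    simp only [dunklX, dunkl, LinearMap.comp_apply, LinearMap.add_apply, LinearMap.smul_apply,
      LinearMap.sum_apply, LinearMap.mulLeft_apply]
    congr 1
    · exact pderiv_X_mul_mono i α
    · rw [← Finset.add_sum_erase _ _ (Finset.mem_univ i)]
      simp
  have h2 : ∑ j ∈ Finset.univ.filter (· < i), act (Equiv.swap i j) (mono α)
      = ∑ j ∈ Finset.univ.erase i, if j < i then mono (compAct (Equiv.swap i j) α) else 0 := by
    rw [Finset.sum_filter, ← Finset.add_sum_erase _ _ (Finset.mem_univ i)]
    simp [act_mono]
  have h3 : cherednik k i (mono α) - kappa k α i • mono α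
      = k • ∑ j ∈ Finset.univ.erase i, ((if h : i ≠ j then divDiff h else 0) (X i * mono α)
        - (if j < i then mono (compAct (Equiv.swap i j) α) else 0)
        - ((if α j ≤ α i then 1 else 0) - (if j < i ∧ α j = α i then 1 else 0) : ℝ) • mono α) := by
    rw [Finset.sum_sub_distrib, Finset.sum_sub_distrib, ← Finset.sum_smul, cherednik_apply, h1, h2,
      kappa_eq]
    module
  rw [h3]
  refine Submodule.smul_mem _ _ (Submodule.sum_mem _ fun j hj => ?_)
  have hij : i ≠ j := (Finset.ne_of_mem_erase hj).symm
  rw [dif_pos hij]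
  exact divDiff_sub_swap_mem hij α

theorem coeff_eq_zero_of_mem_lowerSpan {α β : Comp N} (h : ¬ level β < level α) {f : Poly N}
    (hf : f ∈ lowerSpan α) : f.coeff (expo β) = 0 := by
  have : lowerSpan α ≤ LinearMap.ker (lcoeff ℝ (expo β)) := by
    rw [lowerSpan, Submodule.span_le]
    rintro _ ⟨γ, hγ, rfl⟩
    simp only [SetLike.mem_coe, LinearMap.mem_ker, lcoeff_apply, coeff_mono]
    rw [if_neg]
    rintro rfl
    exact h hγ
  exact this hf

/-- If `α` is of maximal level in `f`, then `U_i` multiplies the coefficient at `x^α` by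
`κ_i(α)`. -/
theorem coeff_cherednik (k : ℝ) (i : Fin N) {f : Poly N} {α : Comp N}
    (hα : ∀ β : Comp N, f.coeff (expo β) ≠ 0 → level β ≤ level α) :
    (cherednik k i f).coeff (expo α) = kappa k α i * f.coeff (expo α) := by
  have key : ∀ β : Comp N, f.coeff (expo β) ≠ 0 → (cherednik k i (mono β)).coeff (expo α)
      = kappa k α i * (mono β).coeff (expo α) := by
    intro β hβ
    have h := coeff_eq_zero_of_mem_lowerSpan (not_lt.mpr (hα β hβ)) (cherednik_mono_sub_mem k i β)
    rw [coeff_sub, coeff_smul, sub_eq_zero, smul_eq_mul] at h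
    rw [h, coeff_mono]
    split_ifs with h'
    · rw [h']
    · simp
  conv_lhs => rw [sum_coeff_smul_mono f]
  conv_rhs => rw [sum_coeff_smul_mono f]
  simp only [map_sum, map_smul, coeff_sum, coeff_smul, smul_eq_mul, Finset.mul_sum]
  refine Finset.sum_congr rfl fun d hd => ?_
  rw [key]
  · ring
  · rw [expo, Equiv.symm_apply_apply]
    exact mem_support_iff.mp hd

/-- A nonzero joint eigenfunction has a leading monomial, and its eigenvalues are those of that
monomial. -/
theorem exists_leading {k : ℝ} {f : Poly N} (hf0 : f ≠ 0) {v : Fin N → ℝ}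
    (hf : ∀ i, cherednik k i f = v i • f) :
    ∃ α : Comp N, v = kappa k α ∧ f.coeff (expo α) ≠ 0 ∧
      ∀ β : Comp N, f.coeff (expo β) ≠ 0 → level β ≤ level α := by
  obtain ⟨d, hd, hmax⟩ := Finset.exists_max_image f.support
    (fun d => level (Finsupp.equivFunOnFinite d : Comp N)) (support_nonempty.mpr hf0)
  have hc : f.coeff (expo (Finsupp.equivFunOnFinite d)) ≠ 0 := by
    rw [expo, Equiv.symm_apply_apply]
    exact mem_support_iff.mp hd
  have hm : ∀ β : Comp N, f.coeff (expo β) ≠ 0 →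
      level β ≤ level (Finsupp.equivFunOnFinite d : Comp N) := fun β hβ => by
    simpa [expo] using hmax (expo β) (mem_support_iff.mpr hβ)
  refine ⟨_, funext fun i => ?_, hc, hm⟩
  have h := coeff_cherednik k i hm
  rw [hf, coeff_smul, smul_eq_mul] at h
  exact mul_right_cancel₀ hc h

/-! ### Rearrangements of compositions and dominance -/

theorem compAct_mul (w v : Equiv.Perm (Fin N)) (α : Comp N) :
    compAct (w * v) α = compAct w (compAct v α) := by
  funext i
  simp [compAct]

theorem compAct_one (α : Comp N) : compAct 1 α = α := by
  funext i
  simp [compAct]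

theorem compAct_apply_apply (w : Equiv.Perm (Fin N)) (α : Comp N) (i : Fin N) :
    compAct w α (w i) = α i := by
  simp [compAct]

theorem plus_compAct (w : Equiv.Perm (Fin N)) (α : Comp N) : plus (compAct w α) = plus α := by
  have h : plus (compAct w α) = α ∘ (w⁻¹ * sortPerm (compAct w α) : Equiv.Perm (Fin N)) := by
    funext i
    simp [plus, compAct]
  have h1 := plus_antitone (compAct w α)
  rw [h] at h1 ⊢
  exact Tuple.unique_antitone h1 (plus_antitone α)

theorem plus_eq_self {α : Comp N} (h : Antitone α) : plus α = α := by
  have h1 : Antitone (α ∘ (1 : Equiv.Perm (Fin N))) := h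
  exact Tuple.unique_antitone (plus_antitone α) h1

theorem sum_filter_le (α : Comp N) (j : Fin N) :
    ∑ x ∈ Finset.univ.filter (· ≤ j), α x = ∑ x, if x ≤ j then α x else 0 :=
  Finset.sum_filter _ _

theorem strictlyDominates_swap {i j : Fin N} (hij : i < j) {α : Comp N} (hα : α i < α j) :
    StrictlyDominates (compAct (Equiv.swap i j) α) α := by
  refine ⟨fun l => ?_, fun h => ?_⟩
  · rw [sum_filter_le, sum_filter_le, ← replaceTwo_swap,
      sum_replaceTwo hij.ne α _ _ (fun x v => if x ≤ l then v else 0), sum_univ_split hij.ne]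
    have : j ≤ l → i ≤ l := fun h => hij.le.trans h
    split_ifs <;> omega
  · have := congrFun h i
    simp [compAct] at this
    omega

theorem Dominates.trans {α β γ : Comp N} (h1 : Dominates α β) (h2 : Dominates β γ) :
    Dominates α γ := fun j => (h2 j).trans (h1 j)

theorem Dominates.antisymm {α β : Comp N} (h1 : Dominates α β) (h2 : Dominates β α) : α = β := by
  funext j
  induction j using WellFoundedLT.induction with
  | ind j ih =>
    have h := le_antisymm (h2 j) (h1 j)
    have hf : Finset.univ.filter (· ≤ j) = insert j (Finset.univ.filter (· < j)) := by
      ext l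
      simp [le_iff_eq_or_lt]
    rw [hf, Finset.sum_insert (by simp), Finset.sum_insert (by simp),
      Finset.sum_congr rfl fun l hl => ih l (by simpa using hl)] at h
    exact Nat.add_right_cancel h

theorem StrictlyDominates.trans {α β γ : Comp N} (h1 : StrictlyDominates α β)
    (h2 : StrictlyDominates β γ) : StrictlyDominates α γ :=
  ⟨h1.1.trans h2.1, fun h => h1.2 (h1.1.antisymm (h ▸ h2.1))⟩

theorem StrictlyDominates.asymm {α β : Comp N} (h1 : StrictlyDominates α β) :
    ¬ StrictlyDominates β α := fun h2 => h1.2 (h1.1.antisymm h2.1)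

/-- Without an adjacent ascent between `a` and `b`, the values from `a` to `b` could never exceed `α
a`. -/
theorem exists_adjacent_lt {α : Comp N} {a b : Fin N} (hab : a < b) (h : α a < α b) :
    ∃ i j : Fin N, (j : ℕ) = i + 1 ∧ a ≤ i ∧ j ≤ b ∧ α i < α j := by
  by_contra! hc
  have key : ∀ n : ℕ, ∀ x : Fin N, (x : ℕ) = a + n → x ≤ b → α x ≤ α a := by
    intro n
    induction n with
    | zero =>
      intro x hx _
      rw [show x = a from Fin.ext hx]
    | succ n ih =>
      intro x hx hxb
      have hy : (a : ℕ) + n < N := by omega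
      have hyx : (⟨a + n, hy⟩ : Fin N) ≤ x := by rw [Fin.le_def]; simp only; omega
      refine (hc ⟨a + n, hy⟩ x (by simp only; omega) ?_ hxb).trans (ih _ rfl (hyx.trans hxb))
      rw [Fin.le_def]
      simp
  refine absurd (key (b - a) b ?_ le_rfl) (not_le.mpr h)
  have : (a : ℕ) < b := hab
  omega

/-! ### The spectral vectors -/

/-- The order in which the entries of `α` are sorted. -/
def Precedes (α : Comp N) (i j : Fin N) : Prop := α j < α i ∨ (α i = α j ∧ i < j)

theorem Precedes.trans {α : Comp N} {i j l : Fin N} (h1 : Precedes α i j) (h2 : Precedes α j l) :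
    Precedes α i l := by
  rcases h1 with h1 | ⟨h1, h1'⟩ <;> rcases h2 with h2 | ⟨h2, h2'⟩
  · exact Or.inl (h2.trans h1)
  · exact Or.inl (h2 ▸ h1)
  · exact Or.inl (h1 ▸ h2)
  · exact Or.inr ⟨h1.trans h2, h1'.trans h2'⟩

theorem Precedes.irrefl {α : Comp N} {i : Fin N} : ¬ Precedes α i i := by
  simp [Precedes]

theorem precedes_trichotomy (α : Comp N) (i j : Fin N) :
    Precedes α i j ∨ i = j ∨ Precedes α j i := by
  unfold Precedes
  rcases lt_trichotomy (α i) (α j) with h | h | h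
  · tauto
  · rcases lt_trichotomy i j with h' | h' | h'
    · tauto
    · tauto
    · exact Or.inr (Or.inr (Or.inr ⟨h.symm, h'⟩))
  · tauto

open Classical in
/-- The position of the entry at `i` in the decreasing order of the entries. -/
def position (α : Comp N) (i : Fin N) : ℕ := (Finset.univ.filter fun s => Precedes α s i).card

/-- The two counts in `κ_i` together give the rank of `i` when entries are sorted decreasingly, ties
broken from left to right. -/
theorem kappa_eq_position (k : ℝ) (α : Comp N) (i : Fin N) :
    kappa k α i = N * k - k * position α i + α i + 1 := by
  classical
  have h : position α i = (Finset.univ.filter fun s => α i < α s).card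
      + (Finset.univ.filter fun s => s < i ∧ α s = α i).card := by
    rw [position, ← Finset.card_union_of_disjoint]
    · congr 1
      ext s
      simp only [Finset.mem_filter, Finset.mem_univ, true_and, Finset.mem_union]
      unfold Precedes
      tauto
    · rw [Finset.disjoint_filter]
      intro s _ h1 h2
      omega
  rw [kappa, h]
  push_cast
  ring

theorem position_lt {α : Comp N} {i j : Fin N} (h : Precedes α i j) :
    position α i < position α j := by
  classical
  refine Finset.card_lt_card (Finset.ssubset_iff_subset_ne.mpr ⟨fun s hs => ?_, fun he => ?_⟩)
  · simp only [Finset.mem_filter, Finset.mem_univ, true_and] at hs ⊢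
    exact hs.trans h
  · have : i ∈ Finset.univ.filter fun s => Precedes α s i := by rw [he]; simpa using h
    exact Precedes.irrefl (by simpa using this)

theorem kappa_sub_ge {k : ℝ} (hk : 0 ≤ k) {α : Comp N} {i j : Fin N} (h : Precedes α i j) :
    (α i : ℝ) - α j + k ≤ kappa k α i - kappa k α j := by
  rw [kappa_eq_position, kappa_eq_position]
  have h1 : (position α i : ℝ) + 1 ≤ position α j := by exact_mod_cast position_lt h
  nlinarith

theorem le_of_precedes {α : Comp N} {i j : Fin N} (h : Precedes α i j) : α j ≤ α i := by
  rcases h with h | h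
  · exact h.le
  · exact h.1.ge

theorem kappa_lt_iff {k : ℝ} (hk : 0 < k) {α : Comp N} {i j : Fin N} :
    kappa k α j < kappa k α i ↔ Precedes α i j := by
  have key : ∀ {i j}, Precedes α i j → kappa k α j < kappa k α i := by
    intro i j h
    have h1 := kappa_sub_ge hk.le h
    have h2 : (α j : ℝ) ≤ α i := by exact_mod_cast le_of_precedes h
    linarith
  refine ⟨fun h => ?_, key⟩
  rcases precedes_trichotomy α i j with h' | rfl | h'
  · exact h'
  · exact absurd h (lt_irrefl _)
  · exact absurd h (key h').not_gt

/-- The spectral vector determines the composition, also up to a permutation. -/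
theorem eq_comp_of_kappa_eq {k : ℝ} (hk : 0 ≤ k) {α β : Comp N} (σ : Equiv.Perm (Fin N))
    (h : ∀ i, kappa k β i = kappa k α (σ i)) (i : Fin N) : β i = α (σ i) := by
  classical
  have hi := h i
  rw [kappa_eq_position, kappa_eq_position] at hi
  -- For `k = 0` the entries are read off directly. For `k > 0` the ordering of the `κ_i` recovers
  -- the positions, and then the entries.
  rcases hk.eq_or_lt with rfl | hk
  · have : (β i : ℝ) = α (σ i) := by linarith
    exact_mod_cast this
  · have hp : position β i = position α (σ i) := by
      refine Finset.card_equiv σ fun s => ?_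
      simp only [Finset.mem_filter, Finset.mem_univ, true_and]
      rw [← kappa_lt_iff hk, ← kappa_lt_iff hk, h, h]
    rw [hp] at hi
    have : (β i : ℝ) = α (σ i) := by linarith
    exact_mod_cast this

theorem kappa_injective {k : ℝ} (hk : 0 ≤ k) {α β : Comp N} (h : kappa k α = kappa k β) : α = β :=
  funext fun i => eq_comp_of_kappa_eq hk 1 (fun i => congrFun h i) i

theorem kappa_sub_of_eq (k : ℝ) {α : Comp N} {i j : Fin N} (hij : (j : ℕ) = i + 1)
    (hα : α i = α j) : kappa k α i - kappa k α j = k := by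
  classical
  have h : position α j = position α i + 1 := by
    rw [position, position, ← Finset.card_insert_of_notMem
      (show i ∉ Finset.univ.filter (fun s => Precedes α s i) by simpa using Precedes.irrefl)]
    congr 1
    ext s
    simp only [Finset.mem_filter, Finset.mem_univ, true_and, Finset.mem_insert]
    simp only [Precedes, hα, Fin.lt_def, Fin.ext_iff]
    constructor
    · rintro (h | h)
      · tauto
      · omega
    · rintro (h | h | h)
      · have : s = i := Fin.ext h
        subst this
        exact Or.inr ⟨hα, by omega⟩
      · tauto
      · exact Or.inr ⟨h.1, by omega⟩
  rw [kappa_eq_position, kappa_eq_position, h, hα]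
  push_cast
  ring

theorem swap_lt_swap {i j : Fin N} (hij : (j : ℕ) = i + 1) {a b : Fin N} (hab : a < b)
    (h : ¬(a = i ∧ b = j)) : Equiv.swap i j a < Equiv.swap i j b := by
  simp only [Equiv.swap_apply_def]
  rw [Fin.lt_def] at *
  simp only [Fin.ext_iff] at *
  split_ifs <;> omega

theorem precedes_swap {i j : Fin N} (hij : (j : ℕ) = i + 1) {α : Comp N} (hα : α i ≠ α j)
    {a b : Fin N} (h : Precedes α a b) :
    Precedes (compAct (Equiv.swap i j) α) (Equiv.swap i j a) (Equiv.swap i j b) := by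
  rw [Precedes, compAct_apply_apply, compAct_apply_apply]
  rcases h with h | ⟨h, h'⟩
  · exact Or.inl h
  · refine Or.inr ⟨h, swap_lt_swap hij h' ?_⟩
    rintro ⟨rfl, rfl⟩
    exact hα h

theorem compAct_swap_swap (i j : Fin N) (α : Comp N) :
    compAct (Equiv.swap i j) (compAct (Equiv.swap i j) α) = α := by
  rw [← compAct_mul, Equiv.swap_mul_self, compAct_one]

/-- Exchanging unequal neighbours does not alter the relative order of equal entries, so each entry
keeps its rank. -/
theorem kappa_swap (k : ℝ) {i j : Fin N} (hij : (j : ℕ) = i + 1) {α : Comp N} (hα : α i ≠ α j)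
    (l : Fin N) :
    kappa k (compAct (Equiv.swap i j) α) (Equiv.swap i j l) = kappa k α l := by
  classical
  have h : position (compAct (Equiv.swap i j) α) (Equiv.swap i j l) = position α l := by
    symm
    refine Finset.card_equiv (Equiv.swap i j) fun s => ?_
    simp only [Finset.mem_filter, Finset.mem_univ, true_and]
    refine ⟨precedes_swap hij hα, fun h => ?_⟩
    have h2 := precedes_swap hij (α := compAct (Equiv.swap i j) α)
      (by simpa [compAct] using hα.symm) h
    simpa [compAct_swap_swap] using h2
  rw [kappa_eq_position, kappa_eq_position, h, compAct_apply_apply]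

/-! ### Joint eigenfunctions -/

/-- `f` is in the joint eigenspace with the spectral vector of `α`. -/
def IsEigen (k : ℝ) (α : Comp N) (f : Poly N) : Prop := ∀ i, cherednik k i f = kappa k α i • f

theorem IsEigen.smul {k : ℝ} {α : Comp N} {f : Poly N} (c : ℝ) (hf : IsEigen k α f) :
    IsEigen k α (c • f) := fun i => by rw [map_smul, hf i, smul_comm]

theorem IsEigen.sub {k : ℝ} {α : Comp N} {f g : Poly N} (hf : IsEigen k α f) (hg : IsEigen k α g) :
    IsEigen k α (f - g) := fun i => by rw [map_sub, hf i, hg i, smul_sub]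

/-- Any monomial of maximal level in `f` has the spectral vector of `f`, hence its exponent is `α`;
a second one of the same level is impossible. -/
theorem IsEigen.leading {k : ℝ} (hk : 0 ≤ k) {α : Comp N} {f : Poly N} (hf : IsEigen k α f)
    (hf0 : f ≠ 0) : f.coeff (expo α) ≠ 0 ∧
      ∀ β : Comp N, f.coeff (expo β) ≠ 0 → β ≠ α → level β < level α := by
  obtain ⟨γ, hγ, hc, hm⟩ := exists_leading hf0 hf
  obtain rfl : α = γ := kappa_injective hk (funext fun i => congrFun hγ i)
  refine ⟨hc, fun β hβ hne => lt_of_le_of_ne (hm β hβ) fun he => hne ?_⟩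
  refine kappa_injective hk (funext fun i => ?_)
  have h := coeff_cherednik k i (f := f) (α := β) fun δ hδ => (hm δ hδ).trans he.ge
  rw [hf i, coeff_smul, smul_eq_mul] at h
  exact (mul_right_cancel₀ hβ h).symm

/-- Multiplicity one: subtracting the multiple of `g` that cancels `x^α` leaves an eigenfunction
without its obligatory leading monomial, that is, zero. -/
theorem IsEigen.eq_smul {k : ℝ} (hk : 0 ≤ k) {α : Comp N} {f g : Poly N} (hf : IsEigen k α f)
    (hg : IsEigen k α g) (hg0 : g ≠ 0) : ∃ c : ℝ, f = c • g := by
  have hc := (hg.leading hk hg0).1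
  refine ⟨f.coeff (expo α) / g.coeff (expo α), ?_⟩
  by_contra hne
  refine ((hf.sub (hg.smul (f.coeff (expo α) / g.coeff (expo α)))).leading hk
    (sub_ne_zero.mpr hne)).1 ?_
  rw [coeff_sub, coeff_smul, smul_eq_mul, div_mul_cancel₀ _ hc, sub_self]

theorem linearIndependent_of_isEigen {k : ℝ} (hk : 0 ≤ k) {ι : Type*} {β : ι → Comp N}
    (hβ : Function.Injective β) {f : ι → Poly N} (hf : ∀ x, IsEigen k (β x) (f x))
    (hf0 : ∀ x, f x ≠ 0) : LinearIndependent ℝ f := by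
  rw [linearIndependent_iff']
  intro s c hs
  by_contra! hne
  obtain ⟨x, hx, hcx⟩ := hne
  -- In a relation, take a term of maximal level: no other term can contribute to its leading
  -- monomial.
  obtain ⟨y, hy, hmax⟩ := Finset.exists_max_image (s.filter (c · ≠ 0)) (fun x => level (β x))
    ⟨x, by simp [hx, hcx]⟩
  rw [Finset.mem_filter] at hy
  have h := congrArg (coeff (expo (β y))) hs
  rw [coeff_sum, coeff_zero, Finset.sum_eq_single y] at h
  · rw [coeff_smul, smul_eq_mul] at h
    exact (mul_ne_zero hy.2 ((hf y).leading hk (hf0 y)).1) h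
  · intro z hz hzy
    rw [coeff_smul, smul_eq_mul]
    by_contra h'
    have hz2 := ((hf z).leading hk (hf0 z)).2 (β y) (right_ne_zero_of_mul h')
      (fun he => hzy (hβ he).symm)
    exact absurd hz2 (not_lt.mpr (hmax z (by simp [hz, left_ne_zero_of_mul h'])))
  · intro h'
    exact absurd hy.1 h'

theorem IsEigen.intertwine {k : ℝ} {i j : Fin N} (hij : (j : ℕ) = i + 1) {α : Comp N} {f : Poly N}
    (hf : IsEigen k α f) (hα : α i ≠ α j) {c : ℝ} (hc : c * (kappa k α i - kappa k α j) = -k) :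
    IsEigen k (compAct (Equiv.swap i j) α) (act (Equiv.swap i j) f + c • f) := by
  intro l
  rw [cherednik_intertwiner k hij hf hc]
  congr 1
  have := kappa_swap k hij hα (Equiv.swap i j l)
  rw [Equiv.swap_apply_self] at this
  exact this.symm

/-- For equal neighbours the gap of the `κ` is `k`, so `s - 1` is the intertwiner. If `s f - f` were
nonzero, its leading exponent would be `sα = α`; but `f` and `s f` have the same coefficient at
`x^α`. -/
theorem IsEigen.act_swap_of_eq {k : ℝ} (hk : 0 ≤ k) {i j : Fin N} (hij : (j : ℕ) = i + 1)
    {α : Comp N} {f : Poly N} (hf : IsEigen k α f) (hα : α i = α j) :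
    act (Equiv.swap i j) f = f := by
  rw [← sub_eq_zero]
  by_contra hne
  have h := fun l => cherednik_intertwiner k hij hf (c := -1)
    (by rw [kappa_sub_of_eq k hij hα]; ring) l
  have hg : act (Equiv.swap i j) f + (-1 : ℝ) • f = act (Equiv.swap i j) f - f := by module
  rw [hg] at h
  obtain ⟨γ, hγ, hc, -⟩ := exists_leading hne h
  have hγα : γ = compAct (Equiv.swap i j) α := funext fun l => by
    rw [eq_comp_of_kappa_eq hk (Equiv.swap i j) (fun l => (congrFun hγ l).symm) l, compAct,
      Equiv.swap_inv]
  rw [hγα, coeff_sub, coeff_act, compAct_swap_eq_self hα, sub_self] at hc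
  exact hc rfl

theorem IsEigen.act_swap_of_antitone {k : ℝ} (hk : 0 ≤ k) {lam : Comp N} (hl : Antitone lam)
    {f : Poly N} (hf : IsEigen k lam f) : ∀ (n : ℕ) (i j : Fin N), (j : ℕ) = i + n →
      lam i = lam j → act (Equiv.swap i j) f = f := by
  intro n
  induction n with
  | zero =>
    intro i j hij _
    rw [show j = i from Fin.ext hij, Equiv.swap_self]
    exact act_one f
  | succ n ih =>
    intro i j hij h
    have hm : (i : ℕ) + 1 < N := by omega
    have h1 : i ≤ (⟨i + 1, hm⟩ : Fin N) := by rw [Fin.le_def]; simp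
    have h2 : (⟨i + 1, hm⟩ : Fin N) ≤ j := by rw [Fin.le_def]; simp only; omega
    have h3 : lam i = lam ⟨i + 1, hm⟩ := le_antisymm (h ▸ hl h2) (hl h1)
    have h4 := hf.act_swap_of_eq hk (j := ⟨i + 1, hm⟩) rfl h3
    have h5 := ih ⟨i + 1, hm⟩ j (by simp only; omega) (h3 ▸ h)
    rcases eq_or_ne (⟨i + 1, hm⟩ : Fin N) j with rfl | hne
    · exact h4
    · have hi : i ≠ ⟨i + 1, hm⟩ := by rw [Ne, Fin.ext_iff]; simp
      have hj : i ≠ j := by rw [Ne, Fin.ext_iff]; omega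
      -- Conjugation by an adjacent swap shortens the distance; since `lam` is decreasing, the
      -- intermediate entries are equal too.
      have : Equiv.swap i j
          = Equiv.swap i ⟨i + 1, hm⟩ * Equiv.swap ⟨i + 1, hm⟩ j * Equiv.swap i ⟨i + 1, hm⟩ := by
        have h6 := Equiv.swap_apply_apply (Equiv.swap i ⟨i + 1, hm⟩) ⟨i + 1, hm⟩ j
        rw [Equiv.swap_apply_right, Equiv.swap_apply_of_ne_of_ne hj.symm hne.symm,
          Equiv.swap_inv] at h6
        exact h6
      rw [this, ← act_act, ← act_act, h4, h5, h4]

/-- An eigenfunction that belongs to a partition is invariant under the stabilizer. -/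
theorem IsEigen.act_of_stabilizer {k : ℝ} (hk : 0 ≤ k) {lam : Comp N} (hl : Antitone lam)
    {f : Poly N} (hf : IsEigen k lam f) : ∀ (n : ℕ) (w : Equiv.Perm (Fin N)), w.support.card ≤ n →
      (∀ i, lam (w i) = lam i) → act w f = f := by
  intro n
  induction n with
  | zero =>
    intro w hw _
    have : w = 1 := by
      rw [← Equiv.Perm.card_support_eq_zero]
      omega
    rw [this, act_one]
  | succ n ih =>
    intro w hw h
    by_cases h1 : w = 1
    · rw [h1, act_one]
    · obtain ⟨x, hx⟩ : ∃ x, w x ≠ x := by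
        by_contra! h2
        exact h1 (Equiv.ext h2)
      have hs : act (Equiv.swap x (w x)) f = f := by
        rcases le_total x (w x) with hle | hle
        · exact hf.act_swap_of_antitone hk hl (w x - x) x (w x)
            (by rw [Fin.le_def] at hle; omega) (h x).symm
        · rw [Equiv.swap_comm]
          exact hf.act_swap_of_antitone hk hl (x - w x) (w x) x
            (by rw [Fin.le_def] at hle; omega) (h x)
      have h3 := ih (Equiv.swap x (w x) * w)
        (by have := Equiv.Perm.card_support_swap_mul hx; omega) fun i => by
          rw [Equiv.Perm.mul_apply, ← h i, Equiv.swap_apply_def]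
          split_ifs with h4 h5
          · rw [h4, h]
          · rw [h5, h]
          · rfl
      rw [← act_act] at h3
      have h4 := congrArg (act (Equiv.swap x (w x))) h3
      rwa [act_swap_swap, hs] at h4

/-! ### The action of the Cherednik operators on the `ω_α` -/

/-- Also true of the default value `0`, so no existence statement is required. -/
theorem omegaPart_isEigen (k : ℝ) (lam : Comp N) : IsEigen k lam (omegaPart k lam) := by
  intro i
  unfold omegaPart
  split_ifs with h
  · obtain ⟨c, g, hg, hfg⟩ := h.choose_spec.1
    rw [hfg, map_smul, hg.1, smul_comm]
  · simp

/-- Two permutations that sort the same composition differ by the stabilizer of the partition, which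
fixes `omegaPart`. -/
theorem act_omega {k : ℝ} (hk : 0 ≤ k) (w : Equiv.Perm (Fin N)) (α : Comp N) :
    act w (omega k α) = omega k (compAct w α) := by
  have h := (omegaPart_isEigen k (plus α)).act_of_stabilizer hk (plus_antitone α) _
    ((sortPerm (compAct w α))⁻¹ * (w * sortPerm α)) le_rfl fun i => by
      conv_lhs => rw [← plus_compAct w α]
      simp [plus, compAct]
  rw [← act_act] at h
  have h2 := congrArg (act (sortPerm (compAct w α))) h
  rw [act_act, mul_inv_cancel, act_one] at h2
  rw [omega, omega, plus_compAct, ← h2, act_act]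

theorem omega_of_antitone {k : ℝ} (hk : 0 ≤ k) {lam : Comp N} (hl : Antitone lam) :
    omega k lam = omegaPart k lam := by
  have h := act_omega hk (sortPerm lam)⁻¹ lam
  have h2 : compAct (sortPerm lam)⁻¹ lam = lam := by
    conv_rhs => rw [← plus_eq_self hl]
    funext i
    simp [compAct, plus]
  rw [h2] at h
  rw [← h, omega, act_act, inv_mul_cancel, act_one, plus_eq_self hl]

theorem sum_filter_lt_univ {M : Type*} [AddCommMonoid M] (i : Fin N) (g : Fin N → M) :
    ∑ l ∈ Finset.univ.filter (· < i), g l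
      = ∑ l ∈ Finset.univ.erase i, if l < i then g l else 0 := by
  rw [Finset.sum_filter, ← Finset.add_sum_erase _ _ (Finset.mem_univ i)]
  simp

/-- Transporting the eigenvalue equation of `ω_{α⁺}` by the sorting permutation gives `U_i` with
another set of transpositions `(i l)`. The two sets differ only in swaps that yield a dominating
composition, and in swaps of equal entries, which the difference of the `κ` absorbs. -/
theorem cherednik_omega_sub_mem {k : ℝ} (hk : 0 ≤ k) (i : Fin N) (α : Comp N) :
    cherednik k i (omega k α) - kappa k α i • omega k α ∈
      Submodule.span ℝ (omega k '' {β : Comp N | plus β = plus α ∧ StrictlyDominates β α}) := by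
  classical
  set w := sortPerm α with hw
  set j := w⁻¹ i with hj
  have hwj : w j = i := by simp [hj]
  have hlam : ∀ l, plus α l = α (w l) := fun l => rfl
  have e1 := congrArg (act w) (omegaPart_isEigen k (plus α) j)
  rw [act_cherednik, map_smul, hwj] at e1
  change dunklX k i (omega k α) + k • omega k α - k • ∑ l ∈ Finset.univ.filter (· < j),
    act (Equiv.swap i (w l)) (omega k α) = kappa k (plus α) j • omega k α at e1
  have e2 : ∑ l ∈ Finset.univ.filter (· < j), act (Equiv.swap i (w l)) (omega k α)
      = ∑ l ∈ Finset.univ.erase i,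
        if w⁻¹ l < j then omega k (compAct (Equiv.swap i l) α) else 0 := by
    rw [Finset.sum_filter, ← Equiv.sum_comp w⁻¹, ← Finset.add_sum_erase _ _ (Finset.mem_univ i)]
    simp [act_omega hk, hj]
  have e3 : kappa k (plus α) j - kappa k α i = -k * ∑ l ∈ Finset.univ.erase i,
      if α l = α i then ((if w⁻¹ l < j then 1 else 0) - (if l < i then 1 else 0) : ℝ) else 0 := by
    have e4 : (Finset.univ.filter fun s => plus α j < plus α s).card
        = (Finset.univ.filter fun s => α i < α s).card :=
      Finset.card_equiv w fun s => by simp [hlam, hwj]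
    have e5 : (Finset.univ.filter fun s => s < j ∧ plus α s = plus α j).card
        = (Finset.univ.filter fun s => w⁻¹ s < j ∧ α s = α i).card :=
      Finset.card_equiv w fun s => by simp [hlam, hwj]
    rw [kappa, kappa, e4, e5, hlam j, hwj]
    have e6 : ((Finset.univ.filter fun s => w⁻¹ s < j ∧ α s = α i).card : ℝ)
        - ((Finset.univ.filter fun s => s < i ∧ α s = α i).card : ℝ)
        = ∑ l ∈ Finset.univ.erase i, if α l = α i then
            ((if w⁻¹ l < j then 1 else 0) - (if l < i then 1 else 0) : ℝ) else 0 := by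
      rw [Finset.card_filter, Finset.card_filter]
      push_cast
      rw [← Finset.sum_sub_distrib, ← Finset.add_sum_erase _ _ (Finset.mem_univ i)]
      simp only [hj, lt_self_iff_false, false_and, if_false, sub_self, zero_add]
      refine Finset.sum_congr rfl fun l _ => ?_
      by_cases h : α l = α i <;> simp [h]
    rw [← e6]
    ring
  have key : cherednik k i (omega k α) - kappa k α i • omega k α
      = k • ∑ l ∈ Finset.univ.erase i,
        ((if w⁻¹ l < j then omega k (compAct (Equiv.swap i l) α) else 0)
          - (if l < i then omega k (compAct (Equiv.swap i l) α) else 0)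
          - (if α l = α i then
            ((if w⁻¹ l < j then 1 else 0) - (if l < i then 1 else 0) : ℝ) else 0) • omega k α) := by
    rw [Finset.sum_sub_distrib, Finset.sum_sub_distrib, ← Finset.sum_smul, ← e2,
      ← sum_filter_lt_univ, cherednik_apply, eq_add_of_sub_eq e1, eq_add_of_sub_eq e3]
    simp only [act_omega hk]
    module
  rw [key]
  refine Submodule.smul_mem _ _ (Submodule.sum_mem _ fun l hl => ?_)
  have hli : l ≠ i := Finset.ne_of_mem_erase hl
  have hmem : ∀ {a b : Fin N}, a < b → α a < α b → omega k (compAct (Equiv.swap a b) α) ∈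
      Submodule.span ℝ (omega k '' {β : Comp N | plus β = plus α ∧ StrictlyDominates β α}) :=
    fun hab h => Submodule.subset_span
      ⟨_, ⟨plus_compAct _ _, strictlyDominates_swap hab h⟩, rfl⟩
  have hpos : ∀ {a b : Fin N}, α a < α b → w⁻¹ b < w⁻¹ a := by
    intro a b h
    by_contra! h'
    have := plus_antitone α h'
    rw [hlam, hlam] at this
    simp at this
    omega
  rcases lt_trichotomy (α l) (α i) with h | h | h
  · rw [if_neg (not_lt.mpr (hpos h).le), if_neg h.ne, zero_smul, sub_zero, zero_sub]
    split_ifs with hlt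
    · rw [Equiv.swap_comm]
      exact Submodule.neg_mem _ (hmem hlt h)
    · simp
  · rw [compAct_swap_eq_self h.symm, if_pos h]
    convert Submodule.zero_mem _ using 1
    split_ifs <;> simp
  · rw [if_pos (hpos h), if_neg h.ne', zero_smul, sub_zero]
    split_ifs with hlt
    · simp
    · rw [sub_zero]
      exact hmem (lt_of_le_of_ne (not_lt.mp hlt) hli.symm) h

/-! ### Existence and uniqueness of `ζ_α` -/

/-- The sum of all entries, weighted by the distances of their positions from the left end. -/
def depth (α : Comp N) : ℕ := ∑ i : Fin N, (i : ℕ) * α i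

theorem depth_swap_lt {i j : Fin N} (h : i < j) {α : Comp N} (hα : α i < α j) :
    depth (compAct (Equiv.swap i j) α) < depth α := by
  rw [← replaceTwo_swap, depth, sum_replaceTwo h.ne α _ _ (fun l x => (l : ℕ) * x), depth,
    sum_univ_split h.ne]
  have h1 : (i : ℕ) < j := h
  nlinarith

theorem kappa_sub_gt {k : ℝ} (hk : 0 ≤ k) {α : Comp N} {i j : Fin N} (hα : α j < α i) :
    k < kappa k α i - kappa k α j := by
  have h := kappa_sub_ge hk (α := α) (Or.inl hα)
  have h2 : (α j : ℝ) < α i := by exact_mod_cast hα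
  linarith

/-- The span of the `ω_α` with `α⁺ = lam`. -/
def omegaSpan (k : ℝ) (lam : Comp N) : Submodule ℝ (Poly N) :=
  Submodule.span ℝ (Set.range fun β : {β : Comp N // plus β = lam} => omega k β.1)

theorem omega_mem_omegaSpan (k : ℝ) {lam α : Comp N} (h : plus α = lam) :
    omega k α ∈ omegaSpan k lam := Submodule.subset_span ⟨⟨α, h⟩, rfl⟩

theorem act_mem_omegaSpan {k : ℝ} (hk : 0 ≤ k) (w : Equiv.Perm (Fin N)) {lam : Comp N}
    {f : Poly N} (hf : f ∈ omegaSpan k lam) : act w f ∈ omegaSpan k lam := by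
  have : omegaSpan k lam ≤ (omegaSpan k lam).comap (act w) := by
    refine Submodule.span_le.mpr ?_
    rintro _ ⟨β, rfl⟩
    simp only [SetLike.mem_coe, Submodule.mem_comap, act_omega hk]
    exact omega_mem_omegaSpan k ((plus_compAct _ _).trans β.2)
  exact this hf

/-- Starting from `ω_lam`, intertwiners at adjacent ascents reach every rearrangement without
leaving the span. -/
theorem exists_isEigen_mem {k : ℝ} (hk : 0 ≤ k) {lam : Comp N} (h0 : omegaPart k lam ≠ 0)
    (α : Comp N) (hα : plus α = lam) : ∃ f ∈ omegaSpan k lam, f ≠ 0 ∧ IsEigen k α f := by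
  induction hn : depth α using Nat.strong_induction_on generalizing α with
  | _ n ih =>
    by_cases hanti : Antitone α
    · obtain rfl : α = lam := (plus_eq_self hanti).symm.trans hα
      refine ⟨omegaPart k α, ?_, h0, omegaPart_isEigen k α⟩
      rw [← omega_of_antitone hk hanti]
      exact omega_mem_omegaSpan k hα
    · obtain ⟨a, b, hab, hlt⟩ : ∃ a b, a < b ∧ α a < α b := by
        by_contra! h
        exact hanti fun a b hab => hab.eq_or_lt.elim (fun e => e ▸ le_rfl) (h a b)
      obtain ⟨i, j, hij, -, -, hαij⟩ := exists_adjacent_lt hab hlt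
      have hlt : i < j := by rw [Fin.lt_def]; omega
      obtain ⟨f, hf, hf0, hfe⟩ := ih _ (hn ▸ depth_swap_lt hlt hαij)
        (compAct (Equiv.swap i j) α) ((plus_compAct _ _).trans hα) rfl
      have hα' : compAct (Equiv.swap i j) α j < compAct (Equiv.swap i j) α i := by
        simpa [compAct] using hαij
      have hgap := kappa_sub_gt hk hα'
      set x := kappa k (compAct (Equiv.swap i j) α) i - kappa k (compAct (Equiv.swap i j) α) j
      have hx : 0 < x := hk.trans_lt hgap
      have hE := hfe.intertwine hij hα'.ne' (c := -(k / x))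
        (by rw [neg_mul, div_mul_cancel₀ _ hx.ne'])
      rw [compAct_swap_swap] at hE
      refine ⟨_, Submodule.add_mem _ (act_mem_omegaSpan hk _ hf) (Submodule.smul_mem _ _ hf), ?_, hE⟩
      -- If the intertwiner killed `f`, then `s f = (k/x) f` and `s² = 1` would give `(k/x)² = 1`,
      -- but the gap `x` exceeds `k`.
      intro h
      have h1 : act (Equiv.swap i j) f = (k / x) • f := by
        rw [eq_neg_of_add_eq_zero_left h]
        module
      have h2 := congrArg (act (Equiv.swap i j)) h1
      rw [act_swap_swap, map_smul, h1, smul_smul] at h2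
      have h3 : (1 - k / x * (k / x)) • f = 0 := by
        rw [sub_smul, one_smul, ← h2, sub_self]
      have h4 : k / x < 1 := (div_lt_one hx).mpr hgap
      have h5 : 0 ≤ k / x := div_nonneg hk hx.le
      rcases smul_eq_zero.mp h3 with h6 | h6
      · nlinarith
      · exact hf0 h6

theorem finite_rearrangements (lam : Comp N) : Finite {β : Comp N // plus β = lam} := by
  refine Finite.of_injective (fun β => sortPerm β.1) fun β γ h => Subtype.ext ?_
  rw [← compAct_sortPerm_plus β.1, ← compAct_sortPerm_plus γ.1, β.2, γ.2]
  exact congrArg (fun w => compAct w lam) h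

/-- A dimension count: the span contains an eigenfunction for each rearrangement, these are
independent, and so its spanning family of the same size is independent. -/
theorem omega_linearIndependent {k : ℝ} (hk : 0 ≤ k) {lam : Comp N} (h0 : omegaPart k lam ≠ 0) :
    LinearIndependent ℝ fun β : {β : Comp N // plus β = lam} => omega k β.1 := by
  have := finite_rearrangements lam
  have := Fintype.ofFinite {β : Comp N // plus β = lam}
  choose f hf hf0 hfe using fun β : {β : Comp N // plus β = lam} =>
    exists_isEigen_mem hk h0 β.1 β.2
  have hli := linearIndependent_of_isEigen hk Subtype.val_injective hfe hf0
  rw [linearIndependent_iff_card_le_finrank_span]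
  have hfin : FiniteDimensional ℝ (omegaSpan k lam) :=
    FiniteDimensional.span_of_finite ℝ (Set.finite_range _)
  have h2 : LinearIndependent ℝ fun β => (⟨f β, hf β⟩ : omegaSpan k lam) :=
    LinearIndependent.of_comp (omegaSpan k lam).subtype hli
  exact h2.fintype_card_le_finrank

/-- The coefficient functionals of the linearly independent family of the `ω_α`. -/
theorem exists_omega_coeff {k : ℝ} (hk : 0 ≤ k) {lam : Comp N} (h0 : omegaPart k lam ≠ 0)
    {α : Comp N} (hα : plus α = lam) :
    ∃ φ : Poly N →ₗ[ℝ] ℝ, φ (omega k α) = 1 ∧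
      ∀ β : Comp N, plus β = lam → β ≠ α → φ (omega k β) = 0 := by
  have hli := omega_linearIndependent hk h0
  obtain ⟨φ, hφ⟩ := LinearMap.exists_extend
    ((Finsupp.lapply (⟨α, hα⟩ : {β : Comp N // plus β = lam})).comp hli.repr)
  have h : ∀ β : {β : Comp N // plus β = lam}, φ (omega k β.1)
      = Finsupp.single β (1 : ℝ) ⟨α, hα⟩ := by
    intro β
    have h1 := LinearMap.congr_fun hφ ⟨omega k β.1, Submodule.subset_span ⟨β, rfl⟩⟩
    rw [LinearMap.comp_apply, LinearMap.comp_apply, hli.repr_eq_single β _ rfl] at h1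
    exact h1
  refine ⟨φ, ?_, fun β hβ hne => ?_⟩
  · rw [h ⟨α, hα⟩, Finsupp.single_eq_same]
  · rw [h ⟨β, hβ⟩, Finsupp.single_eq_of_ne]
    exact fun h' => hne (congrArg Subtype.val h').symm

theorem map_eq_zero_of_mem_span {M : Type*} [AddCommGroup M] [Module ℝ M] {φ : M →ₗ[ℝ] ℝ}
    {s : Set M} (hs : ∀ x ∈ s, φ x = 0) {f : M} (hf : f ∈ Submodule.span ℝ s) : φ f = 0 :=
  (Submodule.span_le.mpr hs : Submodule.span ℝ s ≤ LinearMap.ker φ) hf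

theorem exists_isZeta {k : ℝ} (hk : 0 ≤ k) {α : Comp N} (h0 : omegaPart k (plus α) ≠ 0) :
    ∃ f, IsZeta k α f := by
  classical
  have := finite_rearrangements (plus α)
  have := Fintype.ofFinite {β : Comp N // plus β = plus α}
  obtain ⟨f, hf, hf0, hfe⟩ := exists_isEigen_mem hk h0 α rfl
  obtain ⟨c, hc⟩ := (Submodule.mem_span_range_iff_exists_fun ℝ).mp hf
  -- At a dominance-minimal `γ` of the expansion, triangularity makes `U_i` multiply the coefficient
  -- by `κ_i(γ)`; comparison with the eigenvalue gives `γ = α`.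
  have hmin : ∀ γ, c γ ≠ 0 → (∀ δ, c δ ≠ 0 → ¬ StrictlyDominates γ.1 δ.1) → γ.1 = α := by
    intro γ hγ hδ
    obtain ⟨φ, hφ1, hφ0⟩ := exists_omega_coeff hk h0 γ.2
    refine (kappa_injective hk (funext fun i => ?_)).symm
    have h1 : ∀ δ, c δ ≠ 0 → φ (cherednik k i (omega k δ.1)) = kappa k γ.1 i * φ (omega k δ.1) := by
      intro δ hcδ
      have h2 := map_eq_zero_of_mem_span (φ := φ) (by
        rintro _ ⟨ε, ⟨hε, hε'⟩, rfl⟩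
        refine hφ0 ε (hε.trans δ.2) ?_
        rintro rfl
        exact hδ δ hcδ hε') (cherednik_omega_sub_mem hk i δ.1)
      rw [map_sub, map_smul, sub_eq_zero, smul_eq_mul] at h2
      rw [h2]
      by_cases h3 : δ.1 = γ.1
      · rw [h3]
      · rw [hφ0 _ δ.2 h3, mul_zero, mul_zero]
    have h4 : φ (cherednik k i f) = kappa k γ.1 i * φ f := by
      rw [← hc]
      simp only [map_sum, map_smul, smul_eq_mul, Finset.mul_sum]
      refine Finset.sum_congr rfl fun δ _ => ?_
      by_cases h5 : c δ = 0
      · simp [h5]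
      · rw [h1 δ h5]; ring
    have h6 : φ f = c γ := by
      rw [← hc, map_sum, Finset.sum_eq_single γ]
      · rw [map_smul, hφ1, smul_eq_mul, mul_one]
      · intro δ _ hne
        rw [map_smul, hφ0 _ δ.2 (fun h => hne (Subtype.ext h)), smul_zero]
      · simp
    rw [hfe i, map_smul, smul_eq_mul, h6] at h4
    exact mul_right_cancel₀ hγ h4
  have hwf : WellFounded fun γ δ : {β : Comp N // plus β = plus α} =>
      StrictlyDominates δ.1 γ.1 := by
    have : IsTrans {β : Comp N // plus β = plus α} fun γ δ => StrictlyDominates δ.1 γ.1 :=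
      ⟨fun _ _ _ h1 h2 => h2.trans h1⟩
    have : Std.Irrefl fun γ δ : {β : Comp N // plus β = plus α} => StrictlyDominates δ.1 γ.1 :=
      ⟨fun _ h => h.2 rfl⟩
    exact Finite.wellFounded_of_trans_of_irrefl _
  -- Descending from any `γ` in the support ends at a minimal element, which is `α`. Hence `α`
  -- occurs, and everything else dominates it.
  have hsupp : ∀ γ, c γ ≠ 0 → γ.1 = α ∨ (StrictlyDominates γ.1 α ∧ c ⟨α, rfl⟩ ≠ 0) := by
    intro γ
    induction γ using hwf.induction with
    | _ γ ih =>
      intro hγ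
      by_cases h : ∀ δ, c δ ≠ 0 → ¬ StrictlyDominates γ.1 δ.1
      · exact Or.inl (hmin γ hγ h)
      · push Not at h
        obtain ⟨δ, hδ, hγδ⟩ := h
        rcases ih δ hγδ hδ with h1 | h1
        · obtain rfl : δ = ⟨α, rfl⟩ := Subtype.ext h1
          exact Or.inr ⟨hγδ, hδ⟩
        · exact Or.inr ⟨hγδ.trans h1.1, h1.2⟩
  have hcα : c ⟨α, rfl⟩ ≠ 0 := by
    obtain ⟨γ, hγ⟩ : ∃ γ, c γ ≠ 0 := by
      by_contra! h
      refine hf0 ?_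
      rw [← hc]
      simp [h]
    rcases hsupp γ hγ with h | h
    · rwa [show γ = ⟨α, rfl⟩ from Subtype.ext h] at hγ
    · exact h.2
  refine ⟨(c ⟨α, rfl⟩)⁻¹ • f, hfe.smul _, ?_⟩
  rw [← hc, ← Finset.add_sum_erase _ _ (Finset.mem_univ ⟨α, rfl⟩), smul_add,
    inv_smul_smul₀ hcα, add_sub_cancel_left]
  refine Submodule.smul_mem _ _ (Submodule.sum_mem _ fun γ hγ => ?_)
  by_cases h : c γ = 0
  · simp [h]
  · refine Submodule.smul_mem _ _ (Submodule.subset_span ⟨γ.1, ⟨γ.2, ?_⟩, rfl⟩)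
    rcases hsupp γ h with h1 | h1
    · exact absurd (Subtype.ext h1) (Finset.ne_of_mem_erase hγ)
    · exact h1.1

theorem zeta_spec {k : ℝ} (hk : 0 ≤ k) {α : Comp N} (h0 : omegaPart k (plus α) ≠ 0) :
    IsZeta k α (zeta k α) := by
  have h := exists_isZeta hk h0
  rw [zeta, dif_pos h]
  exact h.choose_spec

theorem zeta_isEigen (k : ℝ) (α : Comp N) : IsEigen k α (zeta k α) := by
  unfold zeta
  split_ifs with h
  · exact h.choose_spec.1
  · intro i
    simp

theorem zeta_eq_zero {k : ℝ} {α : Comp N} (h0 : omegaPart k (plus α) = 0) : zeta k α = 0 := by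
  have hω : ∀ β : Comp N, plus β = plus α → omega k β = 0 := fun β hβ => by
    rw [omega, hβ, h0, map_zero]
  unfold zeta
  split_ifs with h
  · have h1 := h.choose_spec.2
    rw [hω α rfl, sub_zero] at h1
    have h2 : Submodule.span ℝ
        (omega k '' {β : Comp N | plus β = plus α ∧ StrictlyDominates β α}) = ⊥ := by
      rw [Submodule.span_eq_bot]
      rintro _ ⟨β, hβ, rfl⟩
      exact hω β hβ.1
    rw [h2] at h1
    exact h1
  · rfl

/-- A functional that detects only `ω_γ` ignores the tail of `ζ_α` unless `γ ≻ α`. -/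
theorem IsZeta.map_eq {k : ℝ} {α γ : Comp N} {f : Poly N} (hf : IsZeta k α f)
    {φ : Poly N →ₗ[ℝ] ℝ} (hφ : ∀ β : Comp N, plus β = plus α → β ≠ γ → φ (omega k β) = 0)
    (hγ : ¬ StrictlyDominates γ α) : φ f = φ (omega k α) := by
  have h := map_eq_zero_of_mem_span (φ := φ) (by
    rintro _ ⟨ε, ⟨hε, hε'⟩, rfl⟩
    refine hφ ε hε ?_
    rintro rfl
    exact hγ hε') hf.2
  rwa [map_sub, sub_eq_zero] at h

/-- The effect of a simple transposition on the `ζ_α`. -/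
theorem zeta_swap {k : ℝ} (hk : 0 ≤ k) {i j : Fin N} (hij : (j : ℕ) = i + 1) {α : Comp N}
    (hα : α j < α i) :
    zeta k (compAct (Equiv.swap i j) α)
      = act (Equiv.swap i j) (zeta k α) + (-(k / (kappa k α i - kappa k α j))) • zeta k α := by
  by_cases h0 : omegaPart k (plus α) = 0
  · rw [zeta_eq_zero h0, zeta_eq_zero (by rwa [plus_compAct])]
    simp
  set s := Equiv.swap i j with hs
  set β := compAct s α with hβ
  have hplus : plus β = plus α := plus_compAct _ _
  have hsβ : compAct s β = α := compAct_swap_swap i j α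
  have hlt : i < j := by rw [Fin.lt_def]; omega
  have hdom : StrictlyDominates α β := by
    have h := strictlyDominates_swap hlt (α := β) (by simpa [hβ, hs, compAct] using hα)
    rwa [← hs, hsβ] at h
  have hgap := kappa_sub_gt hk hα
  have hz := zeta_spec hk h0
  have hz' := zeta_spec hk (α := β) (by rwa [hplus])
  have hE : IsEigen k β _ := (zeta_isEigen k α).intertwine hij hα.ne'
    (c := -(k / (kappa k α i - kappa k α j)))
    (by rw [neg_mul, div_mul_cancel₀]; linarith)
  -- The coefficient of `ω_β` is `1` in `ζ_β`, and `0` in `ζ_α` because `α ≻ β`. In `s ζ_α` it is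
  -- the coefficient of `ω_α` in `ζ_α`, which is `1`.
  obtain ⟨φ, hφ1, hφ0⟩ := exists_omega_coeff hk h0 hplus
  have h1 : φ (zeta k β) = 1 := by
    rw [hz'.map_eq (fun γ hγ => hφ0 γ (hγ.trans hplus)) (fun h => h.2 rfl), hφ1]
  have h2 : φ (zeta k α) = 0 := by
    rw [hz.map_eq hφ0 hdom.asymm, hφ0 α rfl hdom.2]
  have h3 : φ (act s (zeta k α)) = 1 := by
    have h4 : ∀ γ : Comp N, plus γ = plus α → γ ≠ α → (φ ∘ₗ act s) (omega k γ) = 0 := by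
      intro γ hγ hne
      rw [LinearMap.comp_apply, act_omega hk]
      refine hφ0 _ ((plus_compAct _ _).trans hγ) fun h => hne ?_
      rw [← hsβ, ← h]
      exact (compAct_swap_swap i j γ).symm
    have h5 := hz.map_eq h4 (fun h => h.2 rfl)
    rwa [LinearMap.comp_apply, LinearMap.comp_apply, act_omega hk, hφ1] at h5
  have hne : zeta k β ≠ 0 := fun h => by simp [h] at h1
  obtain ⟨c, hc⟩ := hE.eq_smul hk (zeta_isEigen k β) hne
  have h6 := congrArg φ hc
  rw [map_add, map_smul, map_smul, h1, h2, h3, smul_zero, add_zero, smul_eq_mul, mul_one] at h6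
  rw [hc, ← h6, one_smul]

/-! ### Values at `1^N` and norms -/

theorem evalOne_zeta_swap {k : ℝ} (hk : 0 ≤ k) {i j : Fin N} (hij : (j : ℕ) = i + 1) {α : Comp N}
    (hα : α j < α i) :
    evalOne (zeta k (compAct (Equiv.swap i j) α))
      = (1 - k / (kappa k α i - kappa k α j)) * evalOne (zeta k α) := by
  have h : ∀ (f g : Poly N) (c : ℝ), evalOne (f + c • g) = evalOne f + c * evalOne g := by
    intro f g c
    simp [evalOne, smul_eval]
  rw [zeta_swap hk hij hα, h, evalOne_act]
  ring

theorem IsPermissible.act_act {k : ℝ} {B : LinearMap.BilinForm ℝ (Poly N)}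
    (hB : IsPermissible k B) (w : Equiv.Perm (Fin N)) (f g : Poly N) :
    B (act w f) (act w g) = B f g := by
  rw [hB.invariant, NonsymJack.act_act, inv_mul_cancel, act_one]

theorem IsPermissible.cherednik_selfAdjoint {k : ℝ} {B : LinearMap.BilinForm ℝ (Poly N)}
    (hB : IsPermissible k B) (i : Fin N) (f g : Poly N) :
    B (cherednik k i f) g = B f (cherednik k i g) := by
  have h : ∀ j, B (act (Equiv.swap i j) f) g = B f (act (Equiv.swap i j) g) := fun j => by
    rw [hB.invariant, Equiv.swap_inv]
  simp only [cherednik_apply, map_sub, map_add, map_smul, map_sum, LinearMap.sub_apply,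
    LinearMap.add_apply, LinearMap.smul_apply, LinearMap.sum_apply, hB.selfAdjoint, h]

theorem norm_zeta_swap {k : ℝ} (hk : 0 ≤ k) {B : LinearMap.BilinForm ℝ (Poly N)}
    (hB : IsPermissible k B) {i j : Fin N} (hij : (j : ℕ) = i + 1) {α : Comp N}
    (hα : α j < α i) :
    B (zeta k (compAct (Equiv.swap i j) α)) (zeta k (compAct (Equiv.swap i j) α))
      = (1 + k / (kappa k α i - kappa k α j)) * (1 - k / (kappa k α i - kappa k α j))
        * B (zeta k α) (zeta k α) := by
  have hgap := kappa_sub_gt hk hα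
  set c := k / (kappa k α i - kappa k α j)
  have hz := zeta_swap hk hij hα
  -- `U_i` is self-adjoint and has different eigenvalues on the two functions.
  have horth : B (zeta k (compAct (Equiv.swap i j) α)) (zeta k α) = 0 := by
    have h1 := hB.cherednik_selfAdjoint i (zeta k (compAct (Equiv.swap i j) α)) (zeta k α)
    have h2 := kappa_swap k hij hα.ne' j
    rw [Equiv.swap_apply_right] at h2
    rw [zeta_isEigen, zeta_isEigen, map_smul, map_smul, LinearMap.smul_apply, h2, smul_eq_mul,
      smul_eq_mul] at h1
    have h3 : (kappa k α i - kappa k α j)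
        * B (zeta k (compAct (Equiv.swap i j) α)) (zeta k α) = 0 := by linarith
    rcases mul_eq_zero.mp h3 with h4 | h4
    · linarith
    · exact h4
  have h5 : B (act (Equiv.swap i j) (zeta k α)) (zeta k α) = c * B (zeta k α) (zeta k α) := by
    rw [hz, map_add, map_smul, LinearMap.add_apply, LinearMap.smul_apply, smul_eq_mul] at horth
    linarith
  have h6 := hB.symm (zeta k α) (act (Equiv.swap i j) (zeta k α))
  rw [hz]
  simp only [map_add, map_smul, LinearMap.add_apply, LinearMap.smul_apply, smul_eq_mul,
    hB.act_act, h6, h5]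
  ring

/-! ### Intervals -/

theorem calE_eq_of_satGE (k ε : ℝ) {α : Comp N} {I : Finset (Fin N)} (h : SatGE α I) :
    calE k ε α I = 1 := by
  refine Finset.prod_eq_one fun q hq => ?_
  simp only [Finset.mem_filter, Finset.mem_product] at hq
  exact absurd (h q.1 hq.1.1 q.2 hq.1.2 hq.2.1) (not_le.mpr hq.2.2)

/-- The swap creates the single new ascent `(i, j)`; all other ascents in `I` are permuted, with
their `κ` differences unchanged. -/
theorem calE_swap (k ε : ℝ) {I : Finset (Fin N)} {i j : Fin N} (hi : i ∈ I) (hj : j ∈ I)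
    (hij : (j : ℕ) = i + 1) {α : Comp N} (hα : α j < α i) :
    calE k ε (compAct (Equiv.swap i j) α) I
      = (1 + ε * k / (kappa k α i - kappa k α j)) * calE k ε α I := by
  have hlt : i < j := by rw [Fin.lt_def]; omega
  have hk := kappa_swap k hij hα.ne'
  have hki := hk i
  have hkj := hk j
  rw [Equiv.swap_apply_left] at hki
  rw [Equiv.swap_apply_right] at hkj
  have hI : ∀ a, Equiv.swap i j a ∈ I ↔ a ∈ I := by
    intro a
    rw [Equiv.swap_apply_def]
    split_ifs with h1 h2
    · simp [h1, hi, hj]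
    · simp [h2, hi, hj]
    · rfl
  have hmem : (i, j) ∈ (I ×ˢ I).filter fun q : Fin N × Fin N =>
      q.1 < q.2 ∧ compAct (Equiv.swap i j) α q.1 < compAct (Equiv.swap i j) α q.2 := by
    rw [Finset.mem_filter, Finset.mem_product]
    exact ⟨⟨hi, hj⟩, hlt, by simpa [compAct] using hα⟩
  rw [calE, ← Finset.mul_prod_erase _ _ hmem, hki, hkj]
  congr 1
  symm
  refine Finset.prod_equiv ((Equiv.swap i j).prodCongr (Equiv.swap i j)) ?_ ?_
  · rintro ⟨a, b⟩
    simp only [Finset.mem_filter, Finset.mem_product, Finset.mem_erase, Equiv.prodCongr_apply,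
      Prod.map_apply, compAct_apply_apply, hI, Ne, Prod.mk.injEq]
    constructor
    · rintro ⟨hab, h1, h2⟩
      have hne : ¬(a = i ∧ b = j) := by
        rintro ⟨rfl, rfl⟩
        omega
      have h3 := swap_lt_swap hij h1 hne
      refine ⟨?_, hab, h3, h2⟩
      rintro ⟨h4, h5⟩
      rw [Equiv.swap_apply_eq_iff, Equiv.swap_apply_left] at h4
      rw [Equiv.swap_apply_eq_iff, Equiv.swap_apply_right] at h5
      rw [h4, h5] at h1
      exact h1.asymm hlt
    · rintro ⟨h1, hab, h2, h3⟩
      refine ⟨hab, ?_, h3⟩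
      have h4 := swap_lt_swap hij h2 h1
      rwa [Equiv.swap_apply_self, Equiv.swap_apply_self] at h4
  · rintro ⟨a, b⟩ _
    simp [hk]

theorem apply_inv_of_mem_permsOf {I : Finset (Fin N)} {w : Equiv.Perm (Fin N)}
    (hw : w ∈ permsOf I) {i : Fin N} (hi : i ∉ I) : w⁻¹ i = i := by
  rw [Equiv.Perm.inv_eq_iff_eq, hw i hi]

theorem apply_inv_mem_of_mem_permsOf {I : Finset (Fin N)} {w : Equiv.Perm (Fin N)}
    (hw : w ∈ permsOf I) {i : Fin N} (hi : i ∈ I) : w⁻¹ i ∈ I := by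
  by_contra h
  have h2 := hw _ h
  rw [← Equiv.Perm.mul_apply, mul_inv_cancel, Equiv.Perm.one_apply] at h2
  exact h (h2 ▸ hi)

/-- `α` with large entries to the left of an interval and zeros to the right of it. -/
def extendInterval (l m M : ℕ) (α : Comp N) : Comp N := fun i =>
  if (i : ℕ) < l then M else if (i : ℕ) < l + m then α i else 0

theorem antitone_extendInterval {l m M : ℕ} {α : Comp N} (hM : ∀ i, α i ≤ M)
    (hα : SatGE α (interval N l m)) : Antitone (extendInterval l m M α) := by
  intro a b hab
  rcases hab.eq_or_lt with rfl | hlt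
  · exact le_rfl
  have hlt' : (a : ℕ) < b := hlt
  unfold extendInterval
  split_ifs with h1 h2 h3 h4 h5 h6
  · exact le_rfl
  · omega
  · omega
  · exact hM b
  · exact hα a (by simp [interval]; omega) b (by simp [interval]; omega) hlt
  all_goals omega

/-- Padding outside the interval turns both compositions into decreasing rearrangements of one
another on all of `Fin N`, where such a rearrangement is unique. -/
theorem eq_of_satGE {l m : ℕ} {α β : Comp N} (hα : SatGE α (interval N l m))
    (hβ : SatGE β (interval N l m)) {w : Equiv.Perm (Fin N)} (hw : w ∈ permsOf (interval N l m))
    (h : β = compAct w α) : β = α := by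
  have hM : ∀ i, α i ≤ ∑ i, α i := fun i =>
    Finset.single_le_sum (f := α) (fun _ _ => Nat.zero_le _) (Finset.mem_univ i)
  have h1 := antitone_extendInterval hM hα
  have h2 := antitone_extendInterval (M := ∑ i, α i) (fun i => h ▸ hM _) hβ
  have h3 : extendInterval l m (∑ i, α i) β = extendInterval l m (∑ i, α i) α
      ∘ (w⁻¹ : Equiv.Perm (Fin N)) := by
    funext i
    by_cases hi : i ∈ interval N l m
    · have hi' := apply_inv_mem_of_mem_permsOf hw hi
      simp only [interval, Finset.mem_filter, Finset.mem_univ, true_and] at hi hi'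
      simp only [extendInterval, Function.comp_apply, if_neg (not_lt.mpr hi.1), if_pos hi.2,
        if_neg (not_lt.mpr hi'.1), if_pos hi'.2, h, compAct]
    · rw [Function.comp_apply, apply_inv_of_mem_permsOf hw hi]
      simp only [interval, Finset.mem_filter, Finset.mem_univ, true_and] at hi
      unfold extendInterval
      split_ifs with h4 h5
      · rfl
      · omega
      · rfl
  rw [h3] at h2
  have h4 : extendInterval l m (∑ i, α i) α ∘ (w⁻¹ : Equiv.Perm (Fin N))
      = extendInterval l m (∑ i, α i) α ∘ (1 : Equiv.Perm (Fin N)) := Tuple.unique_antitone h2 h1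
  rw [← h3] at h4
  funext i
  by_cases hi : i ∈ interval N l m
  · have h5 := congrFun h4 i
    simp only [interval, Finset.mem_filter, Finset.mem_univ, true_and] at hi
    simpa [extendInterval, not_lt.mpr hi.1, hi.2] using h5
  · rw [h, compAct, apply_inv_of_mem_permsOf hw hi]

theorem interval_ordConnected {l m : ℕ} {a b i : Fin N} (ha : a ∈ interval N l m)
    (hb : b ∈ interval N l m) (hai : a ≤ i) (hib : i ≤ b) : i ∈ interval N l m := by
  simp only [interval, Finset.mem_filter, Finset.mem_univ, true_and] at *
  rw [Fin.le_def] at hai hib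
  omega

/-- Induction over the rearrangements of `α` inside an interval in which `α` is decreasing. -/
theorem rearrangement_induction {l m : ℕ} {α : Comp N} (hα : SatGE α (interval N l m))
    {P : Comp N → Prop} (base : P α)
    (step : ∀ (β : Comp N) (i j : Fin N), i ∈ interval N l m → j ∈ interval N l m →
      (j : ℕ) = i + 1 → β j < β i → P β → P (compAct (Equiv.swap i j) β))
    (w : Equiv.Perm (Fin N)) (hw : w ∈ permsOf (interval N l m)) : P (compAct w α) := by
  induction hn : depth (compAct w α) using Nat.strong_induction_on generalizing w with
  | _ n ih =>
    by_cases hβ : SatGE (compAct w α) (interval N l m)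
    · rwa [eq_of_satGE hα hβ hw rfl]
    · unfold SatGE at hβ
      push Not at hβ
      obtain ⟨a, ha, b, hb, hab, hlt⟩ := hβ
      obtain ⟨i, j, hij, hai, hjb, hw'⟩ := exists_adjacent_lt hab hlt
      have hilt : i < j := by rw [Fin.lt_def]; omega
      have hi := interval_ordConnected ha hb hai (hilt.le.trans hjb)
      have hj := interval_ordConnected ha hb (hai.trans hilt.le) hjb
      -- Undoing an adjacent ascent lowers `depth`, so the hypothesis applies to the swapped
      -- composition, and `step` swaps back.
      have h1 := ih _ (hn ▸ depth_swap_lt hilt hw') (Equiv.swap i j * w) (fun x hx => by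
        rw [Equiv.Perm.mul_apply, hw x hx, Equiv.swap_apply_of_ne_of_ne]
        · rintro rfl; exact hx hi
        · rintro rfl; exact hx hj) (by rw [compAct_mul])
      have h2 := step _ i j hi hj hij (by simpa [compAct_mul, compAct] using hw') h1
      rwa [compAct_mul, compAct_swap_swap] at h2

end NonsymJack

end

theorem proposition3p12 (N : ℕ) (k : ℝ) (hk : 0 ≤ k) (l m : ℕ) (hlm : l + m ≤ N)
    (α β : NonsymJack.Comp N)
    (hα : NonsymJack.SatGE α (NonsymJack.interval N l m))
    (hβ : ∃ w ∈ NonsymJack.permsOf (NonsymJack.interval N l m), β = NonsymJack.compAct w α) :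
    NonsymJack.evalOne (NonsymJack.zeta k β) =
        NonsymJack.calE k (-1) β (NonsymJack.interval N l m) *
          NonsymJack.evalOne (NonsymJack.zeta k α) ∧
      ∀ B : LinearMap.BilinForm ℝ (NonsymJack.Poly N), NonsymJack.IsPermissible k B →
        B (NonsymJack.zeta k β) (NonsymJack.zeta k β) =
          NonsymJack.calE k 1 β (NonsymJack.interval N l m) *
            NonsymJack.calE k (-1) β (NonsymJack.interval N l m) *
            B (NonsymJack.zeta k α) (NonsymJack.zeta k α) := by
  obtain ⟨w, hw, rfl⟩ := hβ
  refine NonsymJack.rearrangement_induction hα (P := fun β =>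
    NonsymJack.evalOne (NonsymJack.zeta k β) =
        NonsymJack.calE k (-1) β (NonsymJack.interval N l m) *
          NonsymJack.evalOne (NonsymJack.zeta k α) ∧
      ∀ B : LinearMap.BilinForm ℝ (NonsymJack.Poly N), NonsymJack.IsPermissible k B →
        B (NonsymJack.zeta k β) (NonsymJack.zeta k β) =
          NonsymJack.calE k 1 β (NonsymJack.interval N l m) *
            NonsymJack.calE k (-1) β (NonsymJack.interval N l m) *
            B (NonsymJack.zeta k α) (NonsymJack.zeta k α)) ⟨?_, fun B _ => ?_⟩ ?_ w hw
  · rw [NonsymJack.calE_eq_of_satGE _ _ hα, one_mul]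
  · rw [NonsymJack.calE_eq_of_satGE _ _ hα, NonsymJack.calE_eq_of_satGE _ _ hα, one_mul, one_mul]
  · rintro β i j hi hj hij hlt ⟨h1, h2⟩
    refine ⟨?_, fun B hB => ?_⟩
    · rw [NonsymJack.evalOne_zeta_swap hk hij hlt, NonsymJack.calE_swap k _ hi hj hij hlt, h1]
      ring
    · rw [NonsymJack.norm_zeta_swap hk hB hij hlt, NonsymJack.calE_swap k _ hi hj hij hlt,
        NonsymJack.calE_swap k _ hi hj hij hlt, h2 B hB]
      ring
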